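/- **Setting.** Let $\lambda_1,\lambda_2,\lambda_3\in\mathbb C\setminus\mathbb Z$, and let $\mu_1,\mu_2,\mu_3\in\mathbb C$ be distinct and nonzero with $\sum_i\lambda_i=\sum_i\mu_i$. Let $O_i$ ($i=1,2,3$) be the set of rank-one $3\times3$ complex matrices of trace $\lambda_i$, and let $O_4$ be the adjoint orbit of $\mathrm{diag}(-\mu_1,-\mu_2,-\mu_3)$. A *Schlesinger solution* on an open set $U\subset\mathbb C\setminus\{0,1\}$ is a triple of functions $B_1,B_2,B_3$ of $t\in U$ with $B_i(t)\in O_i$ and $B_4(t):=-(B_1+B_2+B_3)(t)\in O_4$, satisfying $$\frac{dB_1}{dt}=\frac{[B_3,B_1]}{t},\qquad \frac{dB_2}{dt}=\frac{[B_3,B_2]}{t-1},\qquad \frac{dB_3}{dt}=\frac{[B_1,B_3]}{t}+\frac{[B_2,B_3]}{t-1}.$$ These are the equations for isomonodromic deformations of the Fuchsian systems $d\Phi/dz=B(z)\Phi$, $B(z)=\frac{B_1}{z}+\frac{B_2}{z-1}+\frac{B_3}{z-t}$. Put $x=\mathrm{Tr}(B_1B_3)$, $y=\mathrm{Tr}(B_2B_3)$,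 $f=\mathrm{Tr}(B_1[B_2,B_3])$, and $$\theta_i=\lambda_i-\mu_1\ (i=1,2,3),\quad \theta_4=\mu_2-\mu_3,\quad \epsilon_i=\theta_i^2/2,\quad 2\epsilon=\epsilon_4-\epsilon_1-\epsilon_2-\epsilon_3,$$ $$H(x,y)=-2\det\begin{pmatrix}\epsilon_1&\epsilon-x-y&x\\ \epsilon-x-y&\epsilon_2&y\\ x&y&\epsilon_3\end{pmatrix},\qquad P(x,y)=H\big(x-\tfrac{\theta_1\theta_3}2,\;y-\tfrac{\theta_2\theta_3}2\big).$$ Let PVI be the sixth Painlevé equation $$\eta''=\Big(\tfrac1\eta+\tfrac1{\eta-1}+\tfrac1{\eta-t}\Big)\tfrac{(\eta')^2}2-\Big(\tfrac1t+\tfrac1{t-1}+\tfrac1{\eta-t}\Big)\eta'+\tfrac{\eta(\eta-1)(\eta-t)}{t^2(t-1)^2}\Big(\alpha+\tfrac{\beta t}{\eta^2}+\tfrac{\gamma(t-1)}{(\eta-1)^2}+\tfrac{\delta t(t-1)}{(\eta-t)^2}\Big)$$ with $\alpha=(\theta_4-1)^2/2$, $\beta=-\theta_1^2/2$, $\gamma=\theta_2^2/2$,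 $\delta=(1-\theta_3^2)/2$. Solutions are holomorphic functions $\eta$ with $\eta(t)\notin\{0,1,t\}$ for all $t$ in the domain. For a Schlesinger solution and a time $t$, choose a basis in which $B_4=\mathrm{diag}(-\mu_1,-\mu_2,-\mu_3)$. The entry of $z(z-1)(z-t)B(z)$ in row 3 and column 2 is then a polynomial of degree at most one in $z$, independent of the choice of basis up to a nonzero factor. If it has a unique zero, denote this zero by $\eta(t)$. **Theorem.** Under these assumptions the following hold. 1. *(Reduction.)* Every Schlesinger solution on an open $U\subset\mathbb C\setminus\{0,1\}$ satisfies $$\frac{dx}{dt}=\frac{f}{t-1},\qquad \frac{dy}{dt}=-\frac ft,\qquad f^2=P(x,y).\qquad(*)$$ 2. *(Generic converse.)* Let $D\subset\mathbb C\setminus\{0,1\}$ be an open disc and let $x,y,f$ be functions on $D$ that satisfy $(*)$, with $f\not\equiv0$ and with $x$, $y$ and $\frac12\big(\sum_i\mu_i^2-\sum_i\lambda_i^2\big)-x-y$ nowhere zero on $D$. Then they come from a Schlesinger solution on $D$, which is unique up to conjugation by a constant element of $GL_3(\mathbb C)$. 3. *(Schlesinger $\Rightarrow$ PVI.)* If,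 for a Schlesinger solution on an open $U\subset\mathbb C\setminus\{0,1\}$, $\eta(t)$ is defined with $\eta(t)\notin\{0,1,t\}$ for all $t\in U$, then $\eta$ is holomorphic on $U$ and solves PVI. Moreover, if $\theta_1,\theta_2,\theta_3\ne0$ and $\theta_4\neq1$, and $B_1(t_0),B_2(t_0),B_3(t_0)$ have no nontrivial common invariant subspace for some $t_0\in U$, then $\eta(t)$ is defined with $\eta(t)\notin\{0,1,t\}$ for all $t\ne t_0$ close enough to $t_0$. 4. *(PVI $\Rightarrow$ Schlesinger.)* For every open disc $D\subset\mathbb C\setminus\{0,1\}$, every solution $\eta$ of PVI on $D$ is obtained in this way from a Schlesinger solution on $D$, which is unique up to conjugation by a constant element of $GL_3(\mathbb C)$. 5. *(Full four-parameter family.)* Every $(\alpha,\beta,\gamma,\delta)\in\mathbb C^4$ other than the six points $(0,-\frac12,0,\frac12)$, $(0,0,\frac12,\frac12)$, $(0,0,0,0)$, $(\frac12,-2,0,\frac12)$, $(\frac12,0,2,\frac12)$, $(\frac12,0,0,-\frac32)$ arises from some $\lambda_i,\mu_i$ as above. -/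

import Mathlib

open scoped Matrix Topology

noncomputable section

namespace RankThree

/-- `3 × 3` complex matrices. -/
abbrev Mat : Type := Matrix (Fin 3) (Fin 3) ℂ

/-- The standing assumptions on the parameters: the traces `lam i` of the rank one residues are not
integers; the residue at infinity, with eigenvalues `-mu i`, is generic, i.e. its eigenvalues are
distinct and nonzero; and the traces of the four residues add up to zero. -/
structure GenericParams (lam mu : Fin 3 → ℂ) : Prop where
  not_int : ∀ i, ∀ n : ℤ, lam i ≠ (n : ℂ)
  distinct : Function.Injective mu
  ne_zero : ∀ i, mu i ≠ 0
  sum_eq : ∑ i, lam i = ∑ i, mu i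

/-- The adjoint orbit of rank one matrices of trace `l` (for `l ≠ 0`). -/
def rankOneOrbit (l : ℂ) : Set Mat := {A | A.rank = 1 ∧ A.trace = l}

/-- The adjoint orbit of the diagonal matrix with entries `-mu i`. -/
def orbitInfinity (mu : Fin 3 → ℂ) : Set Mat :=
  {A | ∃ g : GL (Fin 3) ℂ, A = (g : Mat) * Matrix.diagonal (fun i => -mu i) * ((g⁻¹ : GL (Fin 3) ℂ) : Mat)}

/-- The residue at infinity of the system with residues `B 0, B 1, B 2` at the finite poles. -/
def resInfinity (B : Fin 3 → Mat) : Mat := -(B 0 + B 1 + B 2)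

/-- `B 0, B 1, B 2`, as functions of `t ∈ U`, are the residues at `0, 1, t` of Fuchsian systems with
residues in the prescribed orbits, and they satisfy the Schlesinger equations on `U`. -/
structure IsSchlesingerSolution (lam mu : Fin 3 → ℂ) (U : Set ℂ) (B : ℂ → Fin 3 → Mat) : Prop where
  mem_orbit : ∀ t ∈ U, ∀ i, B t i ∈ rankOneOrbit (lam i)
  mem_orbitInfinity : ∀ t ∈ U, resInfinity (B t) ∈ orbitInfinity mu
  eq_zero : ∀ t ∈ U, ∀ i j, HasDerivAt (fun s => B s 0 i j) ((t⁻¹ • ⁅B t 2, B t 0⁆) i j) t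
  eq_one : ∀ t ∈ U, ∀ i j, HasDerivAt (fun s => B s 1 i j) (((t - 1)⁻¹ • ⁅B t 2, B t 1⁆) i j) t
  eq_t : ∀ t ∈ U, ∀ i j, HasDerivAt (fun s => B s 2 i j)
    ((t⁻¹ • ⁅B t 0, B t 2⁆ + (t - 1)⁻¹ • ⁅B t 1, B t 2⁆) i j) t

/-- Two families of residues over `U` are conjugate by a constant invertible matrix. -/
def ConjugateOn (U : Set ℂ) (B B' : ℂ → Fin 3 → Mat) : Prop :=
  ∃ g : GL (Fin 3) ℂ, ∀ t ∈ U, ∀ i,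
    B' t i = (g : Mat) * B t i * ((g⁻¹ : GL (Fin 3) ℂ) : Mat)

/-- The three residues at the finite poles have no nontrivial common invariant subspace. -/
def IsIrreducible (B : Fin 3 → Mat) : Prop :=
  ∀ W : Submodule ℂ (Fin 3 → ℂ), (∀ i, ∀ u ∈ W, B i *ᵥ u ∈ W) → (W = ⊥ ∨ W = ⊤)

/-- `x = Tr (B₁ B₃)`. -/
def coordX (B : Fin 3 → Mat) : ℂ := (B 0 * B 2).trace

/-- `y = Tr (B₂ B₃)`. -/
def coordY (B : Fin 3 → Mat) : ℂ := (B 1 * B 2).trace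

/-- `f = Tr (B₁ [B₂, B₃])`. -/
def coordF (B : Fin 3 → Mat) : ℂ := (B 0 * ⁅B 1, B 2⁆).trace

/-- The parameters `θ₁, θ₂, θ₃, θ₄` attached to the `lam i` and `mu i`. -/
def theta (lam mu : Fin 3 → ℂ) : Fin 4 → ℂ :=
  ![lam 0 - mu 0, lam 1 - mu 0, lam 2 - mu 0, mu 1 - mu 2]

/-- `ε_i = θ_i² / 2`. -/
def hitchinEps (th : Fin 4 → ℂ) (i : Fin 4) : ℂ := th i ^ 2 / 2

/-- The constant `ε` with `2 ε = ε₄ - ε₁ - ε₂ - ε₃`. -/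
def hitchinEpsBar (th : Fin 4 → ℂ) : ℂ :=
  (hitchinEps th 3 - hitchinEps th 0 - hitchinEps th 1 - hitchinEps th 2) / 2

/-- Hitchin's cubic. -/
def hitchinCubic (th : Fin 4 → ℂ) (x y : ℂ) : ℂ :=
  (-2) * Matrix.det
    !![hitchinEps th 0, hitchinEpsBar th - x - y, x;
       hitchinEpsBar th - x - y, hitchinEps th 1, y;
       x, y, hitchinEps th 2]

/-- The translate of Hitchin's cubic whose square root drives the reduced equations. -/
def cubic (lam mu : Fin 3 → ℂ) (x y : ℂ) : ℂ :=
  hitchinCubic (theta lam mu) (x - theta lam mu 0 * theta lam mu 2 / 2)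
    (y - theta lam mu 1 * theta lam mu 2 / 2)

/-- The reduced equations `dx/dt = f/(t-1)`, `dy/dt = -f/t`, where `f²` is the cubic in `x, y`. -/
def IsReducedSolution (lam mu : Fin 3 → ℂ) (U : Set ℂ) (x y f : ℂ → ℂ) : Prop :=
  ∀ t ∈ U, HasDerivAt x (f t / (t - 1)) t ∧ HasDerivAt y (-f t / t) t ∧
    f t ^ 2 = cubic lam mu (x t) (y t)

/-- The constant value of `Tr (B₁ B₂) + Tr (B₁ B₃) + Tr (B₂ B₃)`. -/
def traceConst (lam mu : Fin 3 → ℂ) : ℂ := (∑ i, mu i ^ 2 - ∑ i, lam i ^ 2) / 2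

/-- The matrix polynomial `z (z - 1) (z - t) B(z)`, where
`B(z) = B₁ / z + B₂ / (z - 1) + B₃ / (z - t)`. -/
def clearedSystem (B : Fin 3 → Mat) (t z : ℂ) : Mat :=
  ((z - 1) * (z - t)) • B 0 + (z * (z - t)) • B 1 + (z * (z - 1)) • B 2

/-- `h` is the unique zero of the off-diagonal entry of `z (z - 1) (z - t) B(z)` in row `3` and
column `2`, in a basis in which the residue at infinity is `diag (-mu₁, -mu₂, -mu₃)`. The
entry is read off (up to a nonzero factor) with a left eigenvector `w` for `-mu₃` and a right
eigenvector `v` for `-mu₂`. -/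
def IsApparentZero (mu : Fin 3 → ℂ) (B : Fin 3 → Mat) (t h : ℂ) : Prop :=
  ∃ w v : Fin 3 → ℂ, w ≠ 0 ∧ v ≠ 0 ∧
    w ᵥ* resInfinity B = (-mu 2) • w ∧ resInfinity B *ᵥ v = (-mu 1) • v ∧
    ∀ z : ℂ, w ⬝ᵥ (clearedSystem B t z *ᵥ v) = 0 ↔ z = h

/-- `η` is a holomorphic solution of the sixth Painlevé equation with parameters `α, β, γ, δ` on the
open set `U`, taking none of the values `0, 1, t`. -/
structure IsPVISolution (α β γ δ : ℂ) (U : Set ℂ) (η : ℂ → ℂ) : Prop where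
  holo : DifferentiableOn ℂ η U
  regular : ∀ t ∈ U, η t ≠ 0 ∧ η t ≠ 1 ∧ η t ≠ t
  eq : ∀ t ∈ U, deriv (deriv η) t =
    (1 / η t + 1 / (η t - 1) + 1 / (η t - t)) * (deriv η t ^ 2 / 2)
    - (1 / t + 1 / (t - 1) + 1 / (η t - t)) * deriv η t
    + η t * (η t - 1) * (η t - t) / (t ^ 2 * (t - 1) ^ 2) *
      (α + β * t / η t ^ 2 + γ * (t - 1) / (η t - 1) ^ 2 + δ * t * (t - 1) / (η t - t) ^ 2)

/-- The Painlevé VI parameters `(α, β, γ, δ)` attached to `θ₁, θ₂, θ₃, θ₄`. -/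
def pviParams (th : Fin 4 → ℂ) : ℂ × ℂ × ℂ × ℂ :=
  ((th 3 - 1) ^ 2 / 2, -th 0 ^ 2 / 2, th 1 ^ 2 / 2, (1 - th 2 ^ 2) / 2)

/-- `η` solves the sixth Painlevé equation with the parameters determined by `lam` and `mu`. -/
def IsAssociatedPVISolution (lam mu : Fin 3 → ℂ) (U : Set ℂ) (η : ℂ → ℂ) : Prop :=
  IsPVISolution (pviParams (theta lam mu)).1 (pviParams (theta lam mu)).2.1
    (pviParams (theta lam mu)).2.2.1 (pviParams (theta lam mu)).2.2.2 U η

end RankThree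

end

/-! Write the rank-one residues as `B i = u_i v_i`, with the columns `u_i` in `U` and the rows `v_i`
in `V` (`IsFrame`). Then `B 0 + B 1 + B 2 = U * V`, and the Gram matrix `G = V * U` has the same
characteristic polynomial, diagonal `lam` and, up to conjugation by diagonal matrices, determines
the triple up to conjugation (`IsFrame.exists_conj`). The Schlesinger equations lift to `U' = U N`,
`V' = -N V`, where `N` is built from the entries of `G` and a free diagonal gauge, so that `G' = G N
- N G`. Conversely, a solution `G` of this Lax equation with the right spectrum gives a Schlesinger
solution by solving a linear equation for `U` (`exists_schlesinger_of_gram`). Uniqueness reduces to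
comparing Gram matrices at the centre of the disc (`conjugateOn_of_gram_eq`). Each converse thus
amounts to finding coordinates for `G` and a gauge preserving their normalization.

For the reduced equations the coordinates are `x`, `y` and the cyclic products `p = G 0 1 * G 1 2 *
G 2 0` and `q = G 0 2 * G 2 1 * G 1 0`. The spectrum fixes `p + q`, while `p q = x y (traceConst - x
- y)` and `f = p - q`; hence `f ^ 2 = (p + q) ^ 2 - 4 p q`, which is the translated cubic.

For Painlevé VI, fix a left eigenvector `w` and a right eigenvector `v` of the residue at infinity,
which is constant in time. The numbers `w B_i v` sum to zero, so up to scale they are functions of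
`t` and the apparent zero `η`. The eigenvector equations express all products `w B_i B_j v` with `i
≠ j` through these and one further number `σ`, the ratio of `w B_0 B_1 v` to the leading
coefficient. In the chart `(η, σ)` the flow has `η'` affine in `σ` with slope `2`, and eliminating
`σ` gives Painlevé VI (`chartForce_eq_pviForce`). Conversely `η` and `η'` recover `σ`, hence `G`
(`chartGram`).

Failure of the chart near a time means that some `w B_i v`, or the leading coefficient, vanishes
identically there. Differentiation then exhibits a common invariant subspace
(`not_eventually_pairing_eq_zero`). The parameter count uses the sign freedom in the `θ_i` and the
common shift of all `lam i` and `mu i`. -/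

open scoped Matrix Topology

namespace RankThree

/-! ### Linear differential equations on a complex disc -/

section ODE

open Metric Set

variable {E : Type*} [NormedAddCommGroup E] [NormedSpace ℂ E]

theorem segment_mem_ball {c z : ℂ} {r s : ℝ} (hz : z ∈ ball c r) (hs : s ∈ Icc (0 : ℝ) 1) :
    c + s * (z - c) ∈ ball c r := by
  rw [mem_ball, dist_eq_norm] at *
  have : ‖c + s * (z - c) - c‖ = s * ‖z - c‖ := by
    rw [add_sub_cancel_left, norm_mul, Complex.norm_real, Real.norm_of_nonneg hs.1]
  rw [this]
  nlinarith [hs.1, hs.2, norm_nonneg (z - c)]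

theorem hasDerivAt_comp_segment {F : ℂ → E} {F' : E} {c z : ℂ} {s : ℝ}
    (h : HasDerivAt F F' (c + s * (z - c))) :
    HasDerivAt (fun u : ℝ => F (c + u * (z - c))) ((z - c) • F') s := by
  have h1 : HasDerivAt (fun u : ℝ => c + (u : ℂ) * (z - c)) (z - c) s := by
    have := ((Complex.ofRealCLM.hasDerivAt (x := s)).mul_const (z - c)).const_add c
    simpa using this
  exact h.scomp s h1

/-- A function on a disc whose derivative is bounded by a multiple of the function, and which
vanishes at the centre, vanishes. -/
theorem eq_zero_of_norm_deriv_le {d d' : ℂ → E} {K : ℂ → ℝ} {c : ℂ} {r : ℝ}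
    (hd : ∀ z ∈ ball c r, HasDerivAt d (d' z) z) (hK : ContinuousOn K (ball c r))
    (hb : ∀ z ∈ ball c r, ‖d' z‖ ≤ K z * ‖d z‖) (h0 : d c = 0) {z : ℂ} (hz : z ∈ ball c r) :
    d z = 0 := by
  -- Grönwall's inequality is applied on the segment from `c` to `z`, where compactness turns `K`
  -- into a constant bound.
  have hmaps : MapsTo (fun s : ℝ => c + (s : ℂ) * (z - c)) (Icc 0 1) (ball c r) :=
    fun s hs => segment_mem_ball hz hs
  obtain ⟨M, hM⟩ := (isCompact_Icc (a := (0 : ℝ)) (b := 1)).exists_bound_of_continuousOn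
    (hK.comp (f := fun s : ℝ => c + (s : ℂ) * (z - c)) (by fun_prop) hmaps)
  have hder : ∀ s ∈ Icc (0 : ℝ) 1, HasDerivAt (fun u : ℝ => d (c + u * (z - c)))
      ((z - c) • d' (c + s * (z - c))) s :=
    fun s hs => hasDerivAt_comp_segment (hd _ (hmaps hs))
  have := eq_zero_of_abs_deriv_le_mul_abs_self_of_eq_zero_right
    (f := fun u : ℝ => d (c + u * (z - c))) (K := ‖z - c‖ * M) (a := 0) (b := 1)
    (fun s hs => (hder s hs).continuousAt.continuousWithinAt)
    (fun s hs => (hder s (Ico_subset_Icc_self hs)).hasDerivWithinAt) (by simpa using h0)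
    (fun s hs => by
      have hs' := Ico_subset_Icc_self hs
      rw [norm_smul, mul_assoc]
      refine mul_le_mul_of_nonneg_left ((hb _ (hmaps hs')).trans ?_) (norm_nonneg _)
      exact mul_le_mul_of_nonneg_right ((le_abs_self _).trans (hM s hs')) (norm_nonneg _))
    1 (right_mem_Icc.2 zero_le_one)
  simpa using this

/-- Integrate the bound along the segment from the centre. This is the induction step that produces
the factorials in Picard iteration. -/
theorem norm_primitive_le {F g : ℂ → E} {c z : ℂ} {r M : ℝ} {n : ℕ}
    (hF : ∀ z ∈ ball c r, HasDerivAt F (g z) z) (h0 : F c = 0)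
    (hg : ∀ z ∈ ball c r, ‖g z‖ ≤ M * ‖z - c‖ ^ n) (hz : z ∈ ball c r) :
    ‖F z‖ ≤ M * ‖z - c‖ ^ (n + 1) / (n + 1) := by
  have hder : ∀ s ∈ Icc (0 : ℝ) 1, HasDerivAt (fun u : ℝ => F (c + u * (z - c)))
      ((z - c) • g (c + s * (z - c))) s :=
    fun s hs => hasDerivAt_comp_segment (hF _ (segment_mem_ball hz hs))
  have hB : ∀ s : ℝ, HasDerivAt (fun u : ℝ => M * ‖z - c‖ ^ (n + 1) / (n + 1) * u ^ (n + 1))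
      (M * ‖z - c‖ ^ (n + 1) * s ^ n) s := by
    intro s
    refine ((hasDerivAt_pow (n + 1) s).const_mul (M * ‖z - c‖ ^ (n + 1) / (n + 1))).congr_deriv ?_
    have : (n : ℝ) + 1 ≠ 0 := by positivity
    push_cast
    field_simp
  have := image_norm_le_of_norm_deriv_right_le_deriv_boundary
    (f := fun u : ℝ => F (c + u * (z - c))) (a := 0) (b := 1)
    (fun s hs => (hder s hs).continuousAt.continuousWithinAt)
    (fun s hs => (hder s (Ico_subset_Icc_self hs)).hasDerivWithinAt) (by simp [h0]) hB
    (fun s hs => by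
      have hs' := Ico_subset_Icc_self hs
      rw [norm_smul]
      refine (mul_le_mul_of_nonneg_left (hg _ (segment_mem_ball hz hs'))
        (norm_nonneg _)).trans (le_of_eq ?_)
      rw [add_sub_cancel_left, norm_mul, Complex.norm_real, Real.norm_of_nonneg hs'.1]
      ring) (right_mem_Icc.2 zero_le_one)
  simpa using this

/-- Linear differential equations with holomorphic coefficients on a disc have global solutions. -/
theorem exists_linear_ode_solution {A : Type*} [NormedRing A] [NormedAlgebra ℂ A] [CompleteSpace A]
    {N : ℂ → A} {c : ℂ} {r : ℝ} (hN : DifferentiableOn ℂ N (ball c r)) :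
    ∃ U : ℂ → A, U c = 1 ∧ ∀ z ∈ ball c r, HasDerivAt U (U z * N z) z := by
  have hprim : ∀ g : {g : ℂ → A // DifferentiableOn ℂ g (ball c r)},
      ∃ F : {g : ℂ → A // DifferentiableOn ℂ g (ball c r)}, F.1 c = 0 ∧
        ∀ z ∈ ball c r, HasDerivAt F.1 (g.1 z * N z) z := by
    intro g
    obtain ⟨F, hF0, hF⟩ := (DifferentiableOn.isExactOn_ball (g.2.mul hN)).with_val_at c 0
    exact ⟨⟨F, fun z hz => (hF z hz).differentiableAt.differentiableWithinAt⟩, hF0, hF⟩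
  choose P hP0 hP using hprim
  -- Picard iterates: `I 0 = 1`, and `I (n + 1)` is the primitive of `I n * N` vanishing at `c`.
  -- Their sum is the solution.
  let I : ℕ → {g : ℂ → A // DifferentiableOn ℂ g (ball c r)} :=
    fun n => Nat.rec ⟨fun _ => 1, differentiableOn_const _⟩ (fun _ g => P g) n
  have hI0 : ∀ z, (I 0).1 z = 1 := fun z => rfl
  have hIc : ∀ n, (I (n + 1)).1 c = 0 := fun n => hP0 (I n)
  have hId : ∀ n, ∀ z ∈ ball c r, HasDerivAt (I (n + 1)).1 ((I n).1 z * N z) z :=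
    fun n => hP (I n)
  refine ⟨fun z => ∑' n, (I n).1 z, ?_, fun z hz => ?_⟩
  · change ∑' n, (I n).1 c = 1
    rw [tsum_eq_single 0, hI0]
    intro n hn
    obtain ⟨m, rfl⟩ := Nat.exists_eq_succ_of_ne_zero hn
    exact hIc m
  -- `N` may be unbounded on the whole disc, so the estimates are made on a smaller one containing
  -- `z`.
  obtain ⟨ρ, hzρ, hρr⟩ := exists_between (mem_ball.1 hz)
  obtain ⟨C, hC⟩ := (isCompact_closedBall c ρ).exists_bound_of_continuousOn
    (hN.continuousOn.mono (closedBall_subset_ball hρr))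
  have hC' : ∀ z ∈ ball c ρ, ‖N z‖ ≤ C := fun z hz => hC z (ball_subset_closedBall hz)
  have hzρ' : z ∈ ball c ρ := hzρ
  have hρ0 : 0 < ρ := dist_nonneg.trans_lt hzρ
  have hC0 : 0 ≤ C := (norm_nonneg _).trans (hC' z hzρ')
  have hsub : ball c ρ ⊆ ball c r := ball_subset_ball hρr.le
  have hbd : ∀ n, ∀ z ∈ ball c ρ,
      ‖(I n).1 z‖ ≤ ‖(1 : A)‖ * C ^ n / n.factorial * ‖z - c‖ ^ n := by
    intro n
    induction n with
    | zero => intro z _; simp [hI0]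
    | succ n ih =>
      intro z hz
      refine (norm_primitive_le (M := ‖(1 : A)‖ * C ^ (n + 1) / n.factorial) (n := n)
        (fun z hz => hId n z (hsub hz)) (hIc n) (fun z hz => ?_) hz).trans (le_of_eq ?_)
      · refine (norm_mul_le _ _).trans ((mul_le_mul (ih z hz) (hC' z hz) (norm_nonneg _)
          (by positivity)).trans (le_of_eq ?_))
        ring
      · rw [Nat.factorial_succ]
        push_cast
        field_simp
  -- The derivative of the `n`-th term: zero for the constant `I 0`, then the shifted sequence,
  -- which makes the differentiated series equal to the sum times `N`.
  let g' : ℕ → ℂ → A := fun n z => Nat.casesOn n 0 (fun m => (I m).1 z * N z)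
  let u : ℕ → ℝ := fun n => Nat.casesOn n 0 (fun m => ‖(1 : A)‖ * C * ((C * ρ) ^ m / m.factorial))
  have hu : Summable u := by
    rw [← summable_nat_add_iff 1]
    exact (Real.summable_pow_div_factorial (C * ρ)).mul_left (‖(1 : A)‖ * C)
  have hbd' : ∀ n, ∀ z ∈ ball c ρ, ‖(I n).1 z‖ ≤ ‖(1 : A)‖ * ((C * ρ) ^ n / n.factorial) := by
    intro n z hz
    refine (hbd n z hz).trans ?_
    rw [mem_ball, dist_eq_norm] at hz
    calc _ ≤ ‖(1 : A)‖ * C ^ n / n.factorial * ρ ^ n := by gcongr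
      _ = _ := by rw [mul_pow]; ring
  have hsum : Summable fun n => (I n).1 z :=
    .of_norm_bounded ((Real.summable_pow_div_factorial (C * ρ)).mul_left ‖(1 : A)‖)
      fun n => hbd' n z hzρ'
  have key := hasDerivAt_tsum_of_isPreconnected (g := fun n => (I n).1) (g' := g') hu isOpen_ball
    (convex_ball c ρ).isPreconnected (fun n y hy => by
      cases n with
      | zero => exact hasDerivAt_const y (1 : A)
      | succ m => exact hId m y (hsub hy))
    (fun n y hy => by
      cases n with
      | zero => simp [g', u]
      | succ m =>
        refine (norm_mul_le _ _).trans ((mul_le_mul (hbd' m y hy) (hC' y hy) (norm_nonneg _)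
          (by positivity)).trans (le_of_eq ?_))
        simp only [u]; ring) hzρ' hsum hzρ'
  refine key.congr_deriv ?_
  rw [← hsum.tsum_mul_right, Summable.tsum_eq_zero_add]
  · simp [g']
  · rw [← summable_nat_add_iff 1]
    exact hsum.mul_right (N z)

end ODE

open Matrix

/-- Entrywise differentiability of a matrix valued function. -/
def HasEntryDerivAt (A : ℂ → Mat) (A' : Mat) (t : ℂ) : Prop :=
  ∀ i j, HasDerivAt (fun s => A s i j) (A' i j) t

namespace HasEntryDerivAt

variable {A B : ℂ → Mat} {A' B' : Mat} {t : ℂ}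

theorem const (M : Mat) : HasEntryDerivAt (fun _ => M) 0 t :=
  fun i j => hasDerivAt_const t (M i j)

theorem add (hA : HasEntryDerivAt A A' t) (hB : HasEntryDerivAt B B' t) :
    HasEntryDerivAt (fun s => A s + B s) (A' + B') t :=
  fun i j => (hA i j).add (hB i j)

theorem neg (hA : HasEntryDerivAt A A' t) : HasEntryDerivAt (fun s => -A s) (-A') t :=
  fun i j => (hA i j).neg

theorem mul (hA : HasEntryDerivAt A A' t) (hB : HasEntryDerivAt B B' t) :
    HasEntryDerivAt (fun s => A s * B s) (A' * B t + A t * B') t := by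
  intro i j
  simp only [Matrix.add_apply, Matrix.mul_apply, ← Finset.sum_add_distrib]
  exact HasDerivAt.fun_sum fun k _ => (hA i k).mul (hB k j)

theorem trace (hA : HasEntryDerivAt A A' t) :
    HasDerivAt (fun s => (A s).trace) A'.trace t := by
  simp only [Matrix.trace, Matrix.diag_apply]
  exact HasDerivAt.fun_sum fun k _ => hA k k

theorem bilin (hA : HasEntryDerivAt A A' t) (w v : Fin 3 → ℂ) :
    HasDerivAt (fun s => w ⬝ᵥ (A s *ᵥ v)) (w ⬝ᵥ (A' *ᵥ v)) t := by
  simp only [dotProduct, mulVec]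
  exact HasDerivAt.fun_sum fun k _ =>
    (HasDerivAt.fun_sum fun l _ => (hA k l).mul_const (v l)).const_mul (w k)

theorem congr_deriv (hA : HasEntryDerivAt A A' t) (h : A' = B') : HasEntryDerivAt A B' t := h ▸ hA

end HasEntryDerivAt

/-! ### Frames of rank-one triples and their Gram matrices -/

/-- The matrices with diagonal `lam` and characteristic polynomial `∏ (x - mu i)`. -/
structure IsSpectral (lam mu : Fin 3 → ℂ) (G : Mat) : Prop where
  diag : ∀ i, G i i = lam i
  det_sub : ∀ x : ℂ, (x • (1 : Mat) - G).det = (x - mu 0) * (x - mu 1) * (x - mu 2)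

/-- The residues are the products of the columns of `U` and the rows of `V`. -/
def IsFrame (B : Fin 3 → Mat) (U V : Mat) : Prop :=
  ∀ i, B i = vecMulVec (fun a => U a i) (V i)

theorem exists_eq_vecMulVec {A : Mat} (h : A.rank = 1) :
    ∃ u v : Fin 3 → ℂ, A = vecMulVec u v := by
  rw [Matrix.rank, finrank_eq_one_iff'] at h
  obtain ⟨⟨u, _⟩, _, hu⟩ := h
  choose v hv using fun j => hu ⟨A.mulVecLin (Pi.single j 1), LinearMap.mem_range_self _ _⟩
  refine ⟨u, v, ?_⟩
  ext i j
  have := congrFun (congrArg Subtype.val (hv j)) i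
  simp at this
  rw [vecMulVec_apply, ← this, mul_comm]

theorem IsFrame.sum_eq {B : Fin 3 → Mat} {U V : Mat} (h : IsFrame B U V) :
    B 0 + B 1 + B 2 = U * V := by
  ext a b
  simp [h 0, h 1, h 2, vecMulVec_apply, Matrix.mul_apply, Fin.sum_univ_three]

/-- Transfers the spectral condition between the sum of the residues `U * V` and the Gram matrix `V
* U`. -/
theorem det_smul_one_sub_mul_comm (U V : Mat) (x : ℂ) :
    (x • (1 : Mat) - V * U).det = (x • (1 : Mat) - U * V).det := by
  have := congrArg (Polynomial.eval x) (charpoly_mul_comm V U)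
  simpa [Matrix.eval_charpoly, Matrix.smul_one_eq_diagonal, Matrix.scalar_apply] using this

theorem det_smul_one_sub_of_mem_orbit {mu : Fin 3 → ℂ} {A : Mat} (h : -A ∈ orbitInfinity mu)
    (x : ℂ) : (x • (1 : Mat) - A).det = (x - mu 0) * (x - mu 1) * (x - mu 2) := by
  obtain ⟨g, hg⟩ := h
  have hA : A = (g : Mat) * (diagonal mu * ((g⁻¹ : GL (Fin 3) ℂ) : Mat)) := by
    rw [← neg_neg A, hg, ← Matrix.neg_mul, ← Matrix.mul_neg, ← mul_assoc]
    congr 2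
    ext i j
    simp [diagonal_apply]
    split_ifs <;> simp
  have hgg : ((g⁻¹ : GL (Fin 3) ℂ) : Mat) * (g : Mat) = 1 := by
    rw [← Units.val_mul, inv_mul_cancel, Units.val_one]
  rw [hA, ← det_smul_one_sub_mul_comm, mul_assoc, hgg, mul_one, smul_one_eq_diagonal,
    diagonal_sub, det_diagonal, Fin.prod_univ_three]

theorem exists_frame {lam mu : Fin 3 → ℂ} (hmu : ∀ i, mu i ≠ 0) {B : Fin 3 → Mat}
    (hB : ∀ i, B i ∈ rankOneOrbit (lam i)) (hinf : resInfinity B ∈ orbitInfinity mu) :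
    ∃ U V : Mat, IsFrame B U V ∧ IsSpectral lam mu (V * U) ∧ IsUnit U := by
  choose u v huv using fun i => exists_eq_vecMulVec (hB i).1
  have hf : IsFrame B (of fun a i => u i a) (of v) := huv
  have hdet := fun x => (det_smul_one_sub_mul_comm _ _ x).trans
    (hf.sum_eq ▸ det_smul_one_sub_of_mem_orbit hinf x)
  refine ⟨_, _, hf, ⟨fun i => ?_, hdet⟩, ?_⟩
  · rw [← (hB i).2, huv i, trace_vecMulVec, mul_apply, dotProduct]
    simp [mul_comm]
  · rw [isUnit_iff_isUnit_det]
    -- At `x = 0` the determinant is, up to sign, the product of the nonzero `mu i`, which forces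
    -- `det U ≠ 0`.
    have h0 := hdet 0
    rw [zero_smul, zero_sub, ← neg_mul, det_mul] at h0
    refine isUnit_iff_ne_zero.2 fun h => ?_
    rw [h, mul_zero] at h0
    simp [hmu] at h0

theorem exists_diagonalization {mu : Fin 3 → ℂ} (hmu : Function.Injective mu) {A : Mat}
    (h : ∀ i, (mu i • (1 : Mat) - A).det = 0) :
    ∃ g : GL (Fin 3) ℂ, A = (g : Mat) * diagonal mu * ((g⁻¹ : GL (Fin 3) ℂ) : Mat) := by
  choose v hv0 hv using fun i => exists_mulVec_eq_zero_iff.2 (h i)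
  have hv' : ∀ i, A *ᵥ v i = mu i • v i := fun i => by
    have := hv i
    rw [sub_mulVec, smul_mulVec, one_mulVec, sub_eq_zero] at this
    exact this.symm
  have hli : LinearIndependent ℂ v :=
    Module.End.eigenvectors_linearIndependent' A.mulVecLin mu hmu v fun i =>
      ⟨Module.End.mem_eigenspace_iff.2 (hv' i), hv0 i⟩
  have hunit : IsUnit (of v)ᵀ :=
    (linearIndependent_cols_iff_isUnit (A := (of v)ᵀ)).1 hli
  obtain ⟨g, hg⟩ := hunit
  refine ⟨g, ?_⟩
  have hAg : A * (g : Mat) = (g : Mat) * diagonal mu := by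
    rw [hg]
    ext a i
    rw [mul_diagonal]
    have := congrFun (hv' i) a
    simpa [mulVec, dotProduct, mul_apply, mul_comm] using this
  rw [← hAg, mul_assoc, ← Units.val_mul, mul_inv_cancel, Units.val_one, mul_one]

theorem neg_mem_orbitInfinity {mu : Fin 3 → ℂ} (hmu : Function.Injective mu) {A : Mat}
    (h : ∀ x : ℂ, (x • (1 : Mat) - A).det = (x - mu 0) * (x - mu 1) * (x - mu 2)) :
    -A ∈ orbitInfinity mu := by
  obtain ⟨g, hg⟩ := exists_diagonalization hmu (A := A) (fun i => by rw [h]; fin_cases i <;> simp)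
  refine ⟨g, ?_⟩
  rw [hg, ← Matrix.neg_mul, ← Matrix.mul_neg]
  congr 2
  ext i j
  simp [diagonal_apply]
  split_ifs <;> simp

/-- Converse to `exists_frame`. An outer product has rank at most one, and the nonzero trace `lam i`
excludes rank zero. -/
theorem IsFrame.mem_orbits {lam mu : Fin 3 → ℂ} (hmu : Function.Injective mu)
    (hlam : ∀ i, lam i ≠ 0) {B : Fin 3 → Mat} {U V : Mat} (hf : IsFrame B U V)
    (hG : IsSpectral lam mu (V * U)) :
    (∀ i, B i ∈ rankOneOrbit (lam i)) ∧ resInfinity B ∈ orbitInfinity mu := by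
  constructor
  · intro i
    have htr : (B i).trace = lam i := by
      rw [← hG.diag i, hf i, trace_vecMulVec, mul_apply, dotProduct]
      simp [mul_comm]
    refine ⟨le_antisymm ?_ ?_, htr⟩
    · rw [hf i]; exact rank_vecMulVec_le _ _
    · by_contra hlt
      have h0 : B i = 0 := by
        have hr : Module.finrank ℂ (LinearMap.range (B i).mulVecLin) = 0 := by
          change ¬ 1 ≤ (B i).rank at hlt
          rw [Matrix.rank] at hlt
          omega
        have := LinearMap.range_eq_bot.1 (Submodule.finrank_eq_zero.1 hr)
        ext a b
        simpa using congrFun (LinearMap.congr_fun this (Pi.single b 1)) a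
      rw [h0, trace_zero] at htr
      exact hlam i htr.symm
  · refine neg_mem_orbitInfinity hmu fun x => ?_
    rw [hf.sum_eq, ← det_smul_one_sub_mul_comm, hG.det_sub]

/-- Frames with the same Gram matrix are conjugate. -/
theorem IsFrame.exists_conj {B B' : Fin 3 → Mat} {U V U' V' : Mat} (h : IsFrame B U V)
    (h' : IsFrame B' U' V') (hU : IsUnit U) (hU' : IsUnit U') (hG : V * U = V' * U') :
    ∃ g : GL (Fin 3) ℂ, ∀ i, B' i = (g : Mat) * B i * ((g⁻¹ : GL (Fin 3) ℂ) : Mat) := by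
  obtain ⟨u, rfl⟩ := hU
  obtain ⟨u', rfl⟩ := hU'
  refine ⟨u' * u⁻¹, fun i => ?_⟩
  have h1 : ((u' * u⁻¹ : GL (Fin 3) ℂ) : Mat) * (u : Mat) = u' := by
    rw [← Units.val_mul, inv_mul_cancel_right]
  have h2 : V * (((u' * u⁻¹)⁻¹ : GL (Fin 3) ℂ) : Mat) = V' := by
    rw [_root_.mul_inv_rev, inv_inv, Units.val_mul, ← mul_assoc, hG, mul_assoc, ← Units.val_mul,
      mul_inv_cancel, Units.val_one, mul_one]
  rw [h i, h' i, mul_vecMulVec, vecMulVec_mul]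
  congr 1
  · ext a
    conv_lhs => rw [← h1]
    simp [mul_apply, mulVec, dotProduct]
  · ext a
    conv_lhs => rw [← h2]
    simp [mul_apply, vecMul, dotProduct]

/-- Rescaling the vectors of a frame. -/
theorem IsFrame.rescale {B : Fin 3 → Mat} {U V : Mat} (h : IsFrame B U V) {d : Fin 3 → ℂ}
    (hd : ∀ i, d i ≠ 0) : IsFrame B (U * diagonal d) (diagonal (fun i => (d i)⁻¹) * V) := by
  intro i
  rw [h i]
  ext a b
  have := hd i
  simp only [vecMulVec_apply, mul_diagonal, diagonal_mul]
  field_simp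

section Invariants

variable {B : Fin 3 → Mat} {U V : Mat}

theorem IsFrame.bilin_eq (h : IsFrame B U V) (w v : Fin 3 → ℂ) (i : Fin 3) :
    w ⬝ᵥ (B i *ᵥ v) = (w ᵥ* U) i * (V *ᵥ v) i := by
  rw [h i, vecMulVec_mulVec]
  simp [dotProduct, vecMul, mulVec, Fin.sum_univ_three]
  ring

theorem IsFrame.mul_eq (h : IsFrame B U V) (i j : Fin 3) :
    B i * B j = (V * U) i j • vecMulVec (fun a => U a i) (V j) := by
  rw [h i, h j, vecMulVec_mul_vecMulVec]
  ext a b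
  simp [vecMulVec_apply, dotProduct, mul_apply, mul_comm, mul_assoc]

theorem IsFrame.coordX_eq (h : IsFrame B U V) :
    coordX B = (V * U) 0 2 * (V * U) 2 0 := by
  rw [coordX, h.mul_eq, trace_smul, trace_vecMulVec, smul_eq_mul]
  simp [dotProduct, mul_apply, mul_comm]

theorem IsFrame.coordY_eq (h : IsFrame B U V) :
    coordY B = (V * U) 1 2 * (V * U) 2 1 := by
  rw [coordY, h.mul_eq, trace_smul, trace_vecMulVec, smul_eq_mul]
  simp [dotProduct, mul_apply, mul_comm]

theorem IsFrame.coordF_eq (h : IsFrame B U V) :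
    coordF B = (V * U) 0 1 * (V * U) 1 2 * (V * U) 2 0
      - (V * U) 0 2 * (V * U) 2 1 * (V * U) 1 0 := by
  have key : ∀ i j k, (B i * (B j * B k)).trace = (V * U) i j * (V * U) j k * (V * U) k i := by
    intro i j k
    rw [h.mul_eq, h i, Matrix.mul_smul, vecMulVec_mul_vecMulVec, trace_smul, trace_vecMulVec]
    simp [dotProduct, mul_apply, Fin.sum_univ_three]
    ring
  rw [coordF, Ring.lie_def, mul_sub, trace_sub, key, key]

end Invariants

/-! ### Spectral relations and the cubic -/

/-- The sum of the two cyclic products of a matrix in `IsSpectral` with given invariants. -/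
noncomputable def cyclicSum (lam mu : Fin 3 → ℂ) (x y : ℂ) : ℂ :=
  mu 0 * mu 1 * mu 2 - lam 0 * lam 1 * lam 2 + lam 0 * y + lam 1 * x
    + lam 2 * (traceConst lam mu - x - y)

/-- The right side is the discriminant `(p + q) ^ 2 - 4 p q` for two numbers with sum `cyclicSum`
and product `x y (traceConst - x - y)`. The cyclic products of the Gram matrix are such numbers, and
`coordF` is their difference. -/
theorem cubic_eq {lam mu : Fin 3 → ℂ} (h : ∑ i, lam i = ∑ i, mu i) (x y : ℂ) :
    cubic lam mu x y =
      cyclicSum lam mu x y ^ 2 - 4 * x * y * (traceConst lam mu - x - y) := by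
  simp only [Fin.sum_univ_three] at h
  have h' : mu 2 = lam 0 + lam 1 + lam 2 - mu 0 - mu 1 := by linear_combination -h
  simp only [cubic, hitchinCubic, hitchinEpsBar, hitchinEps, theta, cyclicSum, traceConst,
    det_fin_three, Fin.sum_univ_three, of_apply, cons_val, h']
  ring

theorem IsSpectral.relations {lam mu : Fin 3 → ℂ} {G : Mat} (hG : IsSpectral lam mu G) :
    G 0 1 * G 1 0 = traceConst lam mu - G 0 2 * G 2 0 - G 1 2 * G 2 1 ∧
    G 0 1 * G 1 2 * G 2 0 + G 0 2 * G 2 1 * G 1 0 =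
      cyclicSum lam mu (G 0 2 * G 2 0) (G 1 2 * G 2 1) := by
  -- The values at `0`, `1`, `-1` determine the coefficients of the monic cubic: trace, second
  -- symmetric function and determinant.
  have h0 := hG.det_sub 0
  have h1 := hG.det_sub 1
  have h2 := hG.det_sub (-1)
  simp [det_fin_three, hG.diag] at h0 h1 h2
  have ht : mu 0 + mu 1 + mu 2 = lam 0 + lam 1 + lam 2 := by
    linear_combination (h1 + h2) / 2 - h0
  have he : G 0 1 * G 1 0 = traceConst lam mu - G 0 2 * G 2 0 - G 1 2 * G 2 1 := by
    simp only [traceConst, Fin.sum_univ_three]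
    linear_combination (h2 - h1) / 2 - (mu 0 + mu 1 + mu 2 + lam 0 + lam 1 + lam 2) / 2 * ht
  refine ⟨he, ?_⟩
  simp only [cyclicSum]
  linear_combination lam 2 * he - h0

/-- The diagonal and two relations between cyclic products determine the spectrum. -/
theorem isSpectral_of_relations {lam mu : Fin 3 → ℂ} (h : ∑ i, lam i = ∑ i, mu i) {G : Mat}
    (hd : ∀ i, G i i = lam i)
    (h1 : G 0 1 * G 1 0 = traceConst lam mu - G 0 2 * G 2 0 - G 1 2 * G 2 1)
    (h2 : G 0 1 * G 1 2 * G 2 0 + G 0 2 * G 2 1 * G 1 0 =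
      cyclicSum lam mu (G 0 2 * G 2 0) (G 1 2 * G 2 1)) : IsSpectral lam mu G := by
  refine ⟨hd, fun x => ?_⟩
  simp only [Fin.sum_univ_three] at h
  simp only [cyclicSum] at h2
  have h3 := h1
  simp only [traceConst, Fin.sum_univ_three] at h3
  simp [det_fin_three, hd]
  linear_combination lam 2 * h1 - h2 - x * h3 - x ^ 2 * h
    + x / 2 * (lam 0 + lam 1 + lam 2 + mu 0 + mu 1 + mu 2) * h

/-! ### Schlesinger flow: reduction, reconstruction from the Gram matrix, uniqueness -/

open Metric

/-- The Schlesinger equations, without conditions on the orbits of the residues. -/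
structure IsSchlesingerFlow (U : Set ℂ) (B : ℂ → Fin 3 → Mat) : Prop where
  zero : ∀ t ∈ U, HasEntryDerivAt (fun s => B s 0) (t⁻¹ • ⁅B t 2, B t 0⁆) t
  one : ∀ t ∈ U, HasEntryDerivAt (fun s => B s 1) ((t - 1)⁻¹ • ⁅B t 2, B t 1⁆) t
  two : ∀ t ∈ U, HasEntryDerivAt (fun s => B s 2)
    (t⁻¹ • ⁅B t 0, B t 2⁆ + (t - 1)⁻¹ • ⁅B t 1, B t 2⁆) t

theorem IsSchlesingerSolution.flow {lam mu : Fin 3 → ℂ} {U : Set ℂ} {B : ℂ → Fin 3 → Mat}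
    (h : IsSchlesingerSolution lam mu U B) : IsSchlesingerFlow U B :=
  ⟨h.eq_zero, h.eq_one, h.eq_t⟩

theorem IsSchlesingerSolution.mono {lam mu : Fin 3 → ℂ} {U U' : Set ℂ} {B : ℂ → Fin 3 → Mat}
    (h : IsSchlesingerSolution lam mu U B) (hU : U' ⊆ U) : IsSchlesingerSolution lam mu U' B :=
  ⟨fun t ht => h.mem_orbit t (hU ht), fun t ht => h.mem_orbitInfinity t (hU ht),
    fun t ht => h.eq_zero t (hU ht), fun t ht => h.eq_one t (hU ht), fun t ht => h.eq_t t (hU ht)⟩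

theorem isReducedSolution_of_schlesinger {lam mu : Fin 3 → ℂ} (hp : GenericParams lam mu)
    {U : Set ℂ} {B : ℂ → Fin 3 → Mat} (h : IsSchlesingerSolution lam mu U B) :
    IsReducedSolution lam mu U (fun t => coordX (B t)) (fun t => coordY (B t))
      (fun t => coordF (B t)) := by
  intro t ht
  have hf := h.flow
  -- By cyclicity of the trace, `c1` and `c2` kill the terms with a repeated residue, and `c3` turns
  -- the remaining ones into `coordF` up to sign.
  have c1 : ∀ X Y : Mat, (⁅X, Y⁆ * X).trace = 0 := fun X Y => by
    rw [Ring.lie_def, sub_mul, trace_sub, Matrix.mul_assoc, trace_mul_comm X, sub_self]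
  have c2 : ∀ X Y : Mat, (X * ⁅X, Y⁆).trace = 0 := fun X Y => by rw [trace_mul_comm, c1]
  have c3 : ∀ X Y Z : Mat, (X * ⁅Y, Z⁆).trace = (⁅X, Y⁆ * Z).trace := fun X Y Z => by
    rw [Ring.lie_def, Ring.lie_def, mul_sub, sub_mul, trace_sub, trace_sub, trace_mul_cycle' X Z Y,
      ← Matrix.mul_assoc, ← Matrix.mul_assoc]
  refine ⟨((hf.zero t ht).mul (hf.two t ht)).trace.congr_deriv ?_,
    ((hf.one t ht).mul (hf.two t ht)).trace.congr_deriv ?_, ?_⟩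
  · simp only [trace_add, mul_add, Matrix.smul_mul, Matrix.mul_smul, trace_smul, c1, c2, coordF,
      smul_eq_mul]
    ring
  · simp only [trace_add, mul_add, Matrix.smul_mul, Matrix.mul_smul, trace_smul, c1, c2, coordF,
      smul_eq_mul, c3]
    have : ⁅B t 1, B t 0⁆ = -⁅B t 0, B t 1⁆ := by rw [Ring.lie_def, Ring.lie_def, neg_sub]
    rw [this, neg_mul, trace_neg]
    ring
  · obtain ⟨P, V, hfr, hs, -⟩ := exists_frame hp.ne_zero (h.mem_orbit t ht) (h.mem_orbitInfinity t ht)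
    beta_reduce
    rw [cubic_eq hp.sum_eq, hfr.coordF_eq, hfr.coordX_eq, hfr.coordY_eq, ← hs.relations.2]
    linear_combination (-4 * (V * P) 0 2 * (V * P) 2 0 * (V * P) 1 2 * (V * P) 2 1) * hs.relations.1

section LinearODE

attribute [local instance] Matrix.linftyOpNormedRing Matrix.linftyOpNormedAlgebra

/-- The submultiplicative norm makes matrices a Banach algebra, so that the Picard series applies;
the conclusion is entrywise and free of the norm. -/
theorem exists_matrix_ode_solution {N : ℂ → Mat} {c : ℂ} {r : ℝ}
    (hN : ∀ i j, DifferentiableOn ℂ (fun t => N t i j) (ball c r)) :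
    ∃ U : ℂ → Mat, U c = 1 ∧ ∀ t ∈ ball c r, HasEntryDerivAt U (U t * N t) t := by
  have : CompleteSpace Mat := FiniteDimensional.complete ℂ Mat
  have hN' : DifferentiableOn ℂ N (ball c r) := by
    have : N = fun t => ∑ i, ∑ j, N t i j • (single i j 1 : Mat) := by
      ext t : 1
      conv_lhs => rw [matrix_eq_sum_single (N t)]
      simp
    rw [this]
    exact DifferentiableOn.fun_sum fun i _ => DifferentiableOn.fun_sum fun j _ =>
      (hN i j).smul_const _
  obtain ⟨U, h0, hU⟩ := exists_linear_ode_solution hN'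
  refine ⟨U, h0, fun t ht i j => ?_⟩
  exact (LinearMap.toContinuousLinearMap (entryLinearMap ℂ ℂ i j)).hasFDerivAt.comp_hasDerivAt t
    (hU t ht)

end LinearODE

/-- The matrix of the linear system satisfied by a frame, where `k` is a choice of gauge. -/
noncomputable def connectionMatrix (k : Fin 3 → ℂ) (G : Mat) (t : ℂ) : Mat :=
  !![-k 0, 0, G 0 2 / t; 0, -k 1, G 1 2 / (t - 1); G 2 0 / t, G 2 1 / (t - 1), -k 2]

/-- Solve `U' = U N` and put `V = G U⁻¹`. The Lax equation gives `V' = -N V`, and the columns of `U`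
times the rows of `V` then satisfy the Schlesinger equations; the gauge `k` cancels in these
products. -/
theorem exists_schlesinger_of_gram {lam mu : Fin 3 → ℂ} (hp : GenericParams lam mu) {c : ℂ} {r : ℝ}
    (hr : 0 < r) (h01 : ball c r ⊆ {0, 1}ᶜ) {G : ℂ → Mat} {k : ℂ → Fin 3 → ℂ}
    (hk : ∀ i, DifferentiableOn ℂ (fun t => k t i) (ball c r))
    (hG : ∀ t ∈ ball c r, HasEntryDerivAt G
      (G t * connectionMatrix (k t) (G t) t - connectionMatrix (k t) (G t) t * G t) t)
    (hs : ∀ t ∈ ball c r, IsSpectral lam mu (G t)) :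
    ∃ (B : ℂ → Fin 3 → Mat) (U V : ℂ → Mat), IsSchlesingerSolution lam mu (ball c r) B ∧
      ∀ t ∈ ball c r, IsFrame (B t) (U t) (V t) ∧ V t * U t = G t ∧ IsUnit (U t) := by
  set N : ℂ → Mat := fun t => connectionMatrix (k t) (G t) t with hNdef
  have ht0 : ∀ t ∈ ball c r, t ≠ 0 ∧ t - 1 ≠ 0 := fun t ht => by
    have := h01 ht
    simpa [sub_eq_zero] using this
  have hN : ∀ i j, DifferentiableOn ℂ (fun t => N t i j) (ball c r) := by
    have hGd : ∀ i j, DifferentiableOn ℂ (fun t => G t i j) (ball c r) :=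
      fun i j t ht => (hG t ht i j).differentiableAt.differentiableWithinAt
    intro i j
    fin_cases i <;> fin_cases j <;> simp [hNdef, connectionMatrix] <;>
      first
      | exact hk _
      | exact (hGd _ _).div differentiableOn_id fun t ht => (ht0 t ht).1
      | exact (hGd _ _).div (differentiableOn_id.sub_const 1) fun t ht => (ht0 t ht).2
  obtain ⟨U, hU0, hU⟩ := exists_matrix_ode_solution hN
  -- The transpose of `X` solves `W' = -N W`, so `U W` is constant, equal to `1`. This supplies the
  -- inverse of `U` on the whole disc.
  obtain ⟨X, hX0, hX⟩ := exists_matrix_ode_solution (N := fun t => -(N t)ᵀ)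
    (fun i j => (hN j i).neg)
  have hW : ∀ t ∈ ball c r, HasEntryDerivAt (fun s => (X s)ᵀ) (-(N t * (X t)ᵀ)) t := by
    intro t ht i j
    refine (hX t ht j i).congr_deriv ?_
    rw [← transpose_transpose (N t), ← transpose_mul, mul_neg]
    rfl
  have hUW : ∀ t ∈ ball c r, U t * (X t)ᵀ = 1 := by
    intro t ht
    have hd : ∀ t ∈ ball c r, HasEntryDerivAt (fun s => U s * (X s)ᵀ) 0 t := fun t ht =>
      ((hU t ht).mul (hW t ht)).congr_deriv (by rw [mul_neg, mul_assoc, add_neg_cancel])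
    have hc : U c * (X c)ᵀ = 1 := by rw [hU0, hX0, transpose_one, mul_one]
    rw [← hc]
    ext i j
    exact isOpen_ball.is_const_of_deriv_eq_zero (𝕜 := ℂ) (f := fun s => (U s * (X s)ᵀ) i j)
      (convex_ball c r).isPreconnected
      (fun s hs => (hd s hs i j).differentiableAt.differentiableWithinAt)
      (fun s hs => (hd s hs i j).deriv) ht (mem_ball_self hr)
  set V : ℂ → Mat := fun t => G t * (X t)ᵀ with hVdef
  have hV : ∀ t ∈ ball c r, HasEntryDerivAt V (-(N t * V t)) t := fun t ht =>
    ((hG t ht).mul (hW t ht)).congr_deriv (by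
      rw [hVdef]
      noncomm_ring)
  have hVU : ∀ t ∈ ball c r, V t * U t = G t := fun t ht => by
    rw [hVdef, mul_assoc, mul_eq_one_comm.1 (hUW t ht), mul_one]
  set B : ℂ → Fin 3 → Mat := fun t i => vecMulVec (fun a => U t a i) (V t i) with hBdef
  have hfr : ∀ t, IsFrame (B t) (U t) (V t) := fun t i => rfl
  have hB : ∀ t ∈ ball c r, ∀ i a b, HasDerivAt (fun s => B s i a b)
      ((U t * N t) a i * V t i b + U t a i * (-(N t * V t)) i b) t :=
    fun t ht i a b => (hU t ht a i).mul (hV t ht i b)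
  have hlie : ∀ t ∈ ball c r, ∀ i j a b, ⁅B t i, B t j⁆ a b =
      G t i j * (U t a i * V t j b) - G t j i * (U t a j * V t i b) := by
    intro t ht i j a b
    rw [Ring.lie_def, (hfr t).mul_eq, (hfr t).mul_eq, hVU t ht]
    simp [vecMulVec_apply]
  have horb := fun t ht => (hfr t).mem_orbits hp.distinct
    (fun i => by simpa using hp.not_int i 0) (by rw [hVU t ht]; exact hs t ht)
  refine ⟨B, U, V, ⟨fun t ht => (horb t ht).1, fun t ht => (horb t ht).2, ?_, ?_, ?_⟩,
    fun t ht => ⟨hfr t, hVU t ht, IsUnit.of_mul_eq_one _ (hUW t ht)⟩⟩ <;>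
  · intro t ht a b
    refine (hB t ht _ a b).congr_deriv ?_
    simp only [Matrix.smul_apply, Matrix.add_apply, hlie t ht, Matrix.neg_apply, mul_apply,
      Fin.sum_univ_three, hNdef, connectionMatrix, of_apply, cons_val, smul_eq_mul]
    have := (ht0 t ht).1
    have := (ht0 t ht).2
    field_simp
    ring

theorem norm_lie_apply_le {X Y : Mat} {p q : ℝ} (hX : ∀ a b, ‖X a b‖ ≤ p) (hY : ∀ a b, ‖Y a b‖ ≤ q)
    (a b : Fin 3) : ‖⁅X, Y⁆ a b‖ ≤ 6 * (p * q) := by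
  have hp : 0 ≤ p := (norm_nonneg _).trans (hX 0 0)
  have hq : 0 ≤ q := (norm_nonneg _).trans (hY 0 0)
  have h1 : ∀ k, ‖X a k * Y k b - Y a k * X k b‖ ≤ 2 * (p * q) := fun k => by
    refine (norm_sub_le _ _).trans ?_
    rw [norm_mul, norm_mul, two_mul]
    refine add_le_add (mul_le_mul (hX _ _) (hY _ _) (norm_nonneg _) hp) ?_
    rw [mul_comm]
    exact mul_le_mul (hX _ _) (hY _ _) (norm_nonneg _) hp
  rw [Ring.lie_def, Matrix.sub_apply, mul_apply, mul_apply, ← Finset.sum_sub_distrib]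
  refine (norm_sum_le_of_le _ fun k _ => h1 k).trans ?_
  simp
  linarith

/-- The right sides are quadratic, and `⁅X, Y⁆ - ⁅X', Y'⁆ = ⁅X - X', Y⁆ + ⁅X', Y - Y'⁆`. So the
difference of two solutions has derivative bounded by a continuous function times the difference,
and Grönwall applies. -/
theorem IsSchlesingerFlow.eqOn {c : ℂ} {r : ℝ} (h01 : ball c r ⊆ {0, 1}ᶜ)
    {B B' : ℂ → Fin 3 → Mat} (h : IsSchlesingerFlow (ball c r) B)
    (h' : IsSchlesingerFlow (ball c r) B') (hc : B c = B' c) {t : ℂ} (ht : t ∈ ball c r) :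
    B t = B' t := by
  have ht0 : ∀ t ∈ ball c r, t ≠ 0 ∧ t - 1 ≠ 0 := fun t ht => by
    have := h01 ht
    simpa [sub_eq_zero] using this
  let b : ℂ → Fin 3 → Fin 3 → Fin 3 → ℂ := fun s i a b => B s i a b
  let b' : ℂ → Fin 3 → Fin 3 → Fin 3 → ℂ := fun s i a b => B' s i a b
  have hbc : ∀ {C : ℂ → Fin 3 → Mat}, IsSchlesingerFlow (ball c r) C →
      ContinuousOn (fun s => (fun i a b => C s i a b : Fin 3 → Fin 3 → Fin 3 → ℂ)) (ball c r) := by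
    intro C hC s hs
    refine ContinuousAt.continuousWithinAt ?_
    refine continuousAt_pi.2 fun i => continuousAt_pi.2 fun a => continuousAt_pi.2 fun e => ?_
    fin_cases i
    · exact (hC.zero s hs a e).continuousAt
    · exact (hC.one s hs a e).continuousAt
    · exact (hC.two s hs a e).continuousAt
  let d' : ℂ → Fin 3 → Fin 3 → Fin 3 → ℂ := fun s => ![
    fun a e => (s⁻¹ • ⁅B s 2, B s 0⁆) a e - (s⁻¹ • ⁅B' s 2, B' s 0⁆) a e,
    fun a e => ((s - 1)⁻¹ • ⁅B s 2, B s 1⁆) a e - ((s - 1)⁻¹ • ⁅B' s 2, B' s 1⁆) a e,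
    fun a e => (s⁻¹ • ⁅B s 0, B s 2⁆ + (s - 1)⁻¹ • ⁅B s 1, B s 2⁆) a e -
      (s⁻¹ • ⁅B' s 0, B' s 2⁆ + (s - 1)⁻¹ • ⁅B' s 1, B' s 2⁆) a e]
  have hd : ∀ s ∈ ball c r, HasDerivAt (fun s => b s - b' s) (d' s) s := by
    intro s hs
    refine hasDerivAt_pi.2 fun i => hasDerivAt_pi.2 fun a => hasDerivAt_pi.2 fun e => ?_
    fin_cases i
    · exact (h.zero s hs a e).sub (h'.zero s hs a e)
    · exact (h.one s hs a e).sub (h'.one s hs a e)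
    · exact (h.two s hs a e).sub (h'.two s hs a e)
  have hentry : ∀ (m : Fin 3 → Fin 3 → Fin 3 → ℂ) (i a e), ‖m i a e‖ ≤ ‖m‖ := fun m i a e =>
    (norm_le_pi_norm (m i a) e).trans ((norm_le_pi_norm (m i) a).trans (norm_le_pi_norm m i))
  have hlie : ∀ s i j a e, ‖⁅B s i, B s j⁆ a e - ⁅B' s i, B' s j⁆ a e‖ ≤
      6 * (‖b s‖ + ‖b' s‖) * ‖b s - b' s‖ := by
    intro s i j a e
    have : ⁅B s i, B s j⁆ a e - ⁅B' s i, B' s j⁆ a e =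
        ⁅B s i - B' s i, B s j⁆ a e + ⁅B' s i, B s j - B' s j⁆ a e := by
      rw [← Matrix.sub_apply, ← Matrix.add_apply]
      refine congrFun (congrFun ?_ a) e
      simp only [Ring.lie_def]
      noncomm_ring
    rw [this]
    refine (norm_add_le _ _).trans ((add_le_add
      (norm_lie_apply_le (hentry (b s - b' s) i) (hentry (b s) j) a e)
      (norm_lie_apply_le (hentry (b' s) i) (hentry (b s - b' s) j) a e)).trans (le_of_eq ?_))
    ring
  have hbound : ∀ s ∈ ball c r, ‖d' s‖ ≤
      (‖s⁻¹‖ + ‖(s - 1)⁻¹‖) * (6 * (‖b s‖ + ‖b' s‖)) * ‖b s - b' s‖ := by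
    intro s _
    have hM : 0 ≤ 6 * (‖b s‖ + ‖b' s‖) * ‖b s - b' s‖ := by positivity
    have h1 : ∀ (u : ℂ) i j a e, ‖u * ⁅B s i, B s j⁆ a e - u * ⁅B' s i, B' s j⁆ a e‖ ≤
        ‖u‖ * (6 * (‖b s‖ + ‖b' s‖) * ‖b s - b' s‖) := fun u i j a e => by
      rw [← mul_sub, norm_mul]
      exact mul_le_mul_of_nonneg_left (hlie s i j a e) (norm_nonneg _)
    have hu := mul_nonneg (norm_nonneg s⁻¹) hM
    have hu' := mul_nonneg (norm_nonneg (s - 1)⁻¹) hM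
    have hpos : 0 ≤ (‖s⁻¹‖ + ‖(s - 1)⁻¹‖) * (6 * (‖b s‖ + ‖b' s‖)) * ‖b s - b' s‖ := by positivity
    refine (pi_norm_le_iff_of_nonneg hpos).2 fun i => (pi_norm_le_iff_of_nonneg hpos).2 fun a =>
      (pi_norm_le_iff_of_nonneg hpos).2 fun e => ?_
    fin_cases i
    · exact (h1 s⁻¹ 2 0 a e).trans (by linarith)
    · exact (h1 (s - 1)⁻¹ 2 1 a e).trans (by linarith)
    · have := norm_add_le_of_le (h1 s⁻¹ 0 2 a e) (h1 (s - 1)⁻¹ 1 2 a e)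
      rw [sub_add_sub_comm] at this
      exact this.trans (by linarith)
  have hK : ContinuousOn (fun s => (‖s⁻¹‖ + ‖(s - 1)⁻¹‖) * (6 * (‖b s‖ + ‖b' s‖))) (ball c r) := by
    refine ContinuousOn.mul (ContinuousOn.add ?_ ?_)
      (((hbc h).norm.add (hbc h').norm).const_smul (6 : ℝ))
    · exact (continuousOn_id.inv₀ fun s hs => (ht0 s hs).1).norm
    · exact ((continuousOn_id.sub continuousOn_const).inv₀ fun s hs => (ht0 s hs).2).norm
  have := eq_zero_of_norm_deriv_le hd hK hbound
    (sub_eq_zero.2 (by simp only [b, b', hc]; rfl)) ht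
  ext i a e
  exact sub_eq_zero.1 (congrFun (congrFun (congrFun this i) a) e)

theorem IsSchlesingerFlow.conj {U : Set ℂ} {B : ℂ → Fin 3 → Mat} (h : IsSchlesingerFlow U B)
    (g : GL (Fin 3) ℂ) : IsSchlesingerFlow U
      (fun t i => (g : Mat) * B t i * ((g⁻¹ : GL (Fin 3) ℂ) : Mat)) := by
  have hgg : ((g⁻¹ : GL (Fin 3) ℂ) : Mat) * (g : Mat) = 1 := by
    rw [← Units.val_mul, inv_mul_cancel, Units.val_one]
  have hlie : ∀ X Y : Mat, ⁅(g : Mat) * X * ((g⁻¹ : GL (Fin 3) ℂ) : Mat),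
      (g : Mat) * Y * ((g⁻¹ : GL (Fin 3) ℂ) : Mat)⁆ =
      (g : Mat) * ⁅X, Y⁆ * ((g⁻¹ : GL (Fin 3) ℂ) : Mat) := by
    have : ∀ X Y : Mat, (g : Mat) * X * ((g⁻¹ : GL (Fin 3) ℂ) : Mat) *
      ((g : Mat) * Y * ((g⁻¹ : GL (Fin 3) ℂ) : Mat)) =
        (g : Mat) * (X * Y) * ((g⁻¹ : GL (Fin 3) ℂ) : Mat) := fun X Y => by
      calc _ = (g : Mat) * X * (((g⁻¹ : GL (Fin 3) ℂ) : Mat) * (g : Mat)) * Y *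
            ((g⁻¹ : GL (Fin 3) ℂ) : Mat) := by noncomm_ring
        _ = _ := by rw [hgg]; noncomm_ring
    intro X Y
    rw [Ring.lie_def, Ring.lie_def, this, this, mul_sub, sub_mul]
  have hder : ∀ {A : ℂ → Mat} {A' : Mat} {t : ℂ}, HasEntryDerivAt A A' t →
      HasEntryDerivAt (fun s => (g : Mat) * A s * ((g⁻¹ : GL (Fin 3) ℂ) : Mat))
        ((g : Mat) * A' * ((g⁻¹ : GL (Fin 3) ℂ) : Mat)) t := fun hA =>
    (((HasEntryDerivAt.const _).mul hA).mul (.const _)).congr_deriv (by simp)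
  exact ⟨fun t ht => (hder (h.zero t ht)).congr_deriv (by simp only [hlie, Matrix.mul_smul, Matrix.smul_mul]),
    fun t ht => (hder (h.one t ht)).congr_deriv (by simp only [hlie, Matrix.mul_smul, Matrix.smul_mul]),
    fun t ht => (hder (h.two t ht)).congr_deriv (by
      simp only [hlie, mul_add, add_mul, Matrix.mul_smul, Matrix.smul_mul])⟩

/-- Solutions whose frames at the centre of a disc have the same Gram matrix are conjugate. -/
theorem conjugateOn_of_gram_eq {c : ℂ} {r : ℝ} (h01 : ball c r ⊆ {0, 1}ᶜ)
    {B B' : ℂ → Fin 3 → Mat} (h : IsSchlesingerFlow (ball c r) B)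
    (h' : IsSchlesingerFlow (ball c r) B') {U V U' V' : Mat} (hf : IsFrame (B c) U V)
    (hf' : IsFrame (B' c) U' V') (hU : IsUnit U) (hU' : IsUnit U') (hG : V * U = V' * U') :
    ConjugateOn (ball c r) B B' := by
  obtain ⟨g, hg⟩ := hf.exists_conj hf' hU hU' hG
  exact ⟨g, fun t ht i => congrFun (h'.eqOn h01 (h.conj g) (funext hg) ht) i⟩

theorem IsFrame.exists_rescaled {B : Fin 3 → Mat} {U V : Mat} (h : IsFrame B U V) (hU : IsUnit U)
    {d : Fin 3 → ℂ} (hd : ∀ i, d i ≠ 0) :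
    ∃ U' V' : Mat, IsFrame B U' V' ∧ IsUnit U' ∧
      ∀ i j, (V' * U') i j = (V * U) i j * d j / d i := by
  refine ⟨_, _, h.rescale hd, hU.mul ?_, fun i j => ?_⟩
  · rw [isUnit_iff_isUnit_det, det_diagonal]
    exact isUnit_iff_ne_zero.2 (Finset.prod_ne_zero_iff.2 fun i _ => hd i)
  · rw [Matrix.mul_assoc, ← Matrix.mul_assoc V, diagonal_mul, mul_diagonal]
    field_simp

/-! ### The generic converse for the reduced equations -/

/-- The Gram matrix of a frame, normalized by the entries `1` in the last column, as a function of
the reduced coordinates. -/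
noncomputable def reducedGram (lam mu : Fin 3 → ℂ) (x y f : ℂ) : Mat :=
  !![lam 0, (cyclicSum lam mu x y + f) / 2 / x, 1;
     (cyclicSum lam mu x y - f) / 2 / y, lam 1, 1;
     x, y, lam 2]

theorem isSpectral_reducedGram {lam mu : Fin 3 → ℂ} (h : ∑ i, lam i = ∑ i, mu i) {x y f : ℂ}
    (hx : x ≠ 0) (hy : y ≠ 0) (hf : f ^ 2 = cubic lam mu x y) :
    IsSpectral lam mu (reducedGram lam mu x y f) := by
  rw [cubic_eq h] at hf
  refine isSpectral_of_relations h (fun i => by fin_cases i <;> rfl) ?_ ?_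
  · simp only [reducedGram, of_apply, cons_val]
    field_simp
    linear_combination -hf
  · simp only [reducedGram, of_apply, cons_val]
    field_simp
    ring

theorem IsFrame.exists_reducedGram {lam mu : Fin 3 → ℂ} {B : Fin 3 → Mat} {U V : Mat}
    (h : IsFrame B U V) (hU : IsUnit U) (hs : IsSpectral lam mu (V * U))
    (hx : coordX B ≠ 0) (hy : coordY B ≠ 0) :
    ∃ U' V' : Mat, IsFrame B U' V' ∧ IsUnit U' ∧
      V' * U' = reducedGram lam mu (coordX B) (coordY B) (coordF B) := by
  have hr := hs.relations.2
  rw [← h.coordX_eq, ← h.coordY_eq] at hr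
  have hF := h.coordF_eq
  have hX := h.coordX_eq
  have hY := h.coordY_eq
  have hX0 := hx
  have hY0 := hy
  rw [hX, mul_ne_zero_iff] at hX0
  rw [hY, mul_ne_zero_iff] at hY0
  -- Rescaling by `d` multiplies the entry `(i, j)` by `d j / d i`. This `d`, the last column with
  -- final entry `1`, makes the off-diagonal entries of the last column `1` and those of the last
  -- row `x` and `y`.
  obtain ⟨U', V', hf', hU', hG'⟩ := h.exists_rescaled hU (d := ![(V * U) 0 2, (V * U) 1 2, 1])
    (fun i => by fin_cases i <;> simp [hX0.1, hY0.1])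
  refine ⟨U', V', hf', hU', ?_⟩
  rw [reducedGram, ← hr, hF, hX, hY]
  have h1 := hX0.1
  have h2 := hX0.2
  have h3 := hY0.1
  have h4 := hY0.2
  ext i j
  rw [hG']
  fin_cases i <;> fin_cases j <;> simp [hs.diag, h1, h3] <;> try field_simp

/-- Differentiating the cubic relation and cancelling `f` gives `f'`, hence the equations of both
cyclic products; these are the Lax equation for `reducedGram` in a suitable gauge. -/
theorem exists_schlesinger_of_reduced {lam mu : Fin 3 → ℂ} (hp : GenericParams lam mu)
    {c : ℂ} {r : ℝ} {x y f : ℂ → ℂ} (hr : 0 < r) (h01 : ball c r ⊆ {0, 1}ᶜ)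
    (h : IsReducedSolution lam mu (ball c r) x y f) (hf0 : ∃ t ∈ ball c r, f t ≠ 0)
    (hne : ∀ t ∈ ball c r, x t ≠ 0 ∧ y t ≠ 0) :
    ∃ (B : ℂ → Fin 3 → Mat) (U V : ℂ → Mat), IsSchlesingerSolution lam mu (ball c r) B ∧
      ∀ t ∈ ball c r, IsFrame (B t) (U t) (V t) ∧
        V t * U t = reducedGram lam mu (x t) (y t) (f t) ∧ IsUnit (U t) := by
  have ht0 : ∀ t ∈ ball c r, t ≠ 0 ∧ t - 1 ≠ 0 := fun t ht => by
    have := h01 ht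
    simpa [sub_eq_zero] using this
  have hxd : DifferentiableOn ℂ x (ball c r) :=
    fun t ht => (h t ht).1.differentiableAt.differentiableWithinAt
  have hyd : DifferentiableOn ℂ y (ball c r) :=
    fun t ht => (h t ht).2.1.differentiableAt.differentiableWithinAt
  have hfd : DifferentiableOn ℂ f (ball c r) := by
    -- Differentiability of `f` is not given: it follows from `f = (t - 1) x'`, since derivatives of
    -- holomorphic functions are holomorphic.
    refine ((differentiableOn_id.sub_const 1).mul (hxd.deriv isOpen_ball)).congr fun t ht => ?_
    have := (ht0 t ht).2
    simp only [Pi.mul_apply, (h t ht).1.deriv, id]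
    field_simp
  let S : ℂ → ℂ := fun t => cyclicSum lam mu (x t) (y t)
  let w : ℂ → ℂ := fun t => traceConst lam mu - x t - y t
  let Λ : ℂ → ℂ := fun t => lam 1 / (t - 1) - lam 0 / t - lam 2 * (1 / (t - 1) - 1 / t)
  let Y : ℂ → ℂ := fun t => y t * w t / (t - 1) - x t * w t / t
    - x t * y t * (1 / (t - 1) - 1 / t)
  have hwder : ∀ t ∈ ball c r, HasDerivAt w (-(f t / (t - 1)) - (-f t / t)) t := fun t ht =>
    ((h t ht).1.const_sub _).sub (h t ht).2.1
  have hSder : ∀ t ∈ ball c r, HasDerivAt S (f t * Λ t) t := by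
    intro t ht
    refine ((((h t ht).2.1.const_mul (lam 0)).const_add
      (mu 0 * mu 1 * mu 2 - lam 0 * lam 1 * lam 2)).add ((h t ht).1.const_mul (lam 1))).add
      ((hwder t ht).const_mul (lam 2)) |>.congr_deriv ?_
    simp only [Λ]
    ring
  have hfder : ∀ t ∈ ball c r, HasDerivAt f (S t * Λ t - 2 * Y t) t := by
    have hwd : DifferentiableOn ℂ w (ball c r) :=
      fun t ht => (hwder t ht).differentiableAt.differentiableWithinAt
    have hSd : DifferentiableOn ℂ S (ball c r) :=
      fun t ht => (hSder t ht).differentiableAt.differentiableWithinAt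
    have hi0 : DifferentiableOn ℂ (fun t : ℂ => t) (ball c r) := differentiableOn_id
    have hi1 : DifferentiableOn ℂ (fun t : ℂ => t - 1) (ball c r) := hi0.sub_const 1
    have hc : ∀ a : ℂ, DifferentiableOn ℂ (fun _ : ℂ => a) (ball c r) :=
      fun a => differentiableOn_const a
    have hd : DifferentiableOn ℂ (fun t => deriv f t - (S t * Λ t - 2 * Y t)) (ball c r) := by
      have n0 := fun t ht => (ht0 t ht).1
      have n1 := fun t ht => (ht0 t ht).2
      refine (hfd.deriv isOpen_ball).sub (.sub (hSd.mul ?_) ((hc 2).mul ?_))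
      · exact (((hc _).div hi1 n1).sub ((hc _).div hi0 n0)).sub
          ((hc _).mul (((hc 1).div hi1 n1).sub ((hc 1).div hi0 n0)))
      · exact (((hyd.mul hwd).div hi1 n1).sub ((hxd.mul hwd).div hi0 n0)).sub
          ((hxd.mul hyd).mul (((hc 1).div hi1 n1).sub ((hc 1).div hi0 n0)))
    -- The derivative of `f ^ 2 = S ^ 2 - 4 x y w` determines `f'` only after multiplication by `f`.
    -- As `f` is not identically zero, the identity theorem removes the factor, also at the zeros of
    -- `f`.
    have hmul : ∀ t ∈ ball c r, f t * (deriv f t - (S t * Λ t - 2 * Y t)) = 0 := by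
      intro t ht
      have hfa := (hfd.differentiableAt (isOpen_ball.mem_nhds ht)).hasDerivAt
      have h1 := (hfa.mul hfa)
      have h2 := ((hSder t ht).mul (hSder t ht)).sub
        ((((h t ht).1.mul (h t ht).2.1).mul (hwder t ht)).const_mul 4)
      have heq : (fun t => f t * f t) =ᶠ[𝓝 t] fun t => S t * S t - 4 * (x t * y t * w t) := by
        filter_upwards [isOpen_ball.mem_nhds ht] with s hs
        have := (h s hs).2.2
        rw [cubic_eq hp.sum_eq] at this
        simp only [S, w]
        linear_combination this
      have := h1.unique (h2.congr_of_eventuallyEq heq)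
      simp only [Pi.mul_apply] at this
      simp only [Y]
      linear_combination this / 2
    have hfan := hfd.analyticOnNhd isOpen_ball
    have hdan := hd.analyticOnNhd isOpen_ball
    rcases hfan.eq_zero_or_eq_zero_of_mul_eq_zero hdan hmul (convex_ball c r).isPreconnected with
      h0 | h0
    · obtain ⟨t, ht, hne⟩ := hf0
      exact absurd (h0 t ht) hne
    · intro t ht
      exact (hfd.differentiableAt (isOpen_ball.mem_nhds ht)).hasDerivAt.congr_deriv
        (sub_eq_zero.1 (h0 t ht))
  let p : ℂ → ℂ := fun t => (S t + f t) / 2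
  let q : ℂ → ℂ := fun t => (S t - f t) / 2
  have hpder : ∀ t ∈ ball c r, HasDerivAt p (p t * Λ t - Y t) t := fun t ht =>
    (((hSder t ht).add (hfder t ht)).div_const 2).congr_deriv (by simp only [p]; ring)
  have hqder : ∀ t ∈ ball c r, HasDerivAt q (-q t * Λ t + Y t) t := fun t ht =>
    (((hSder t ht).sub (hfder t ht)).div_const 2).congr_deriv (by simp only [q]; ring)
  have hpq : ∀ t ∈ ball c r, p t * q t = x t * y t * w t := by
    intro t ht
    have := (h t ht).2.2
    rw [cubic_eq hp.sum_eq] at this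
    simp only [p, q, S, w]
    linear_combination -this / 4
  have hfpq : ∀ t, f t = p t - q t := fun t => by simp only [p, q]; ring
  have hxder : ∀ t ∈ ball c r, HasDerivAt x ((p t - q t) / (t - 1)) t := fun t ht => by
    rw [← hfpq]; exact (h t ht).1
  have hyder : ∀ t ∈ ball c r, HasDerivAt y (-(p t - q t) / t) t := fun t ht => by
    rw [← hfpq]; exact (h t ht).2.1
  let G : ℂ → Mat := fun t => !![lam 0, p t / x t, 1; q t / y t, lam 1, 1; x t, y t, lam 2]
  -- The gauge is determined, with last component `0`, by requiring the entries `1` in the last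
  -- column to stay constant.
  let k : ℂ → Fin 3 → ℂ := fun t => ![(lam 2 - lam 0) / t - p t / x t / (t - 1),
    (lam 2 - lam 1) / (t - 1) - q t / y t / t, 0]
  refine exists_schlesinger_of_gram hp hr h01 (G := G) (k := k) ?_ ?_ fun t ht =>
    isSpectral_reducedGram hp.sum_eq (hne t ht).1 (hne t ht).2 (h t ht).2.2
  · have hi0 : DifferentiableOn ℂ (fun t : ℂ => t) (ball c r) := differentiableOn_id
    have hi1 : DifferentiableOn ℂ (fun t : ℂ => t - 1) (ball c r) := hi0.sub_const 1
    have hpd : DifferentiableOn ℂ p (ball c r) :=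
      fun t ht => (hpder t ht).differentiableAt.differentiableWithinAt
    have hqd : DifferentiableOn ℂ q (ball c r) :=
      fun t ht => (hqder t ht).differentiableAt.differentiableWithinAt
    have n0 := fun t ht => (ht0 t ht).1
    have n1 := fun t ht => (ht0 t ht).2
    intro i
    fin_cases i
    · exact ((differentiableOn_const _).div hi0 n0).sub
        ((hpd.div hxd fun t ht => (hne t ht).1).div hi1 n1)
    · exact ((differentiableOn_const _).div hi1 n1).sub
        ((hqd.div hyd fun t ht => (hne t ht).2).div hi0 n0)
    · exact differentiableOn_const _
  · intro t ht i j
    obtain ⟨n0, n1⟩ := ht0 t ht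
    obtain ⟨nx, ny⟩ := hne t ht
    have key := hpq t ht
    have hpx := (hpder t ht).div (hxder t ht) nx
    have hqy := (hqder t ht).div (hyder t ht) ny
    fin_cases i <;> fin_cases j
    · refine (hasDerivAt_const t (lam 0)).congr_deriv ?_
      simp [G, k, connectionMatrix]
      ring
    · refine hpx.congr_deriv ?_
      simp [G, k, connectionMatrix]
      simp only [Y, Λ]
      field_simp
      linear_combination (y t * t + x t - x t * t) * key
    · refine (hasDerivAt_const t (1 : ℂ)).congr_deriv ?_
      simp [G, k, connectionMatrix]
      ring
    · refine hqy.congr_deriv ?_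
      simp [G, k, connectionMatrix]
      simp only [Y, Λ]
      field_simp
      linear_combination (-x t + x t * t - y t * t) * key
    · refine (hasDerivAt_const t (lam 1)).congr_deriv ?_
      simp [G, k, connectionMatrix]
      ring
    · refine (hasDerivAt_const t (1 : ℂ)).congr_deriv ?_
      simp [G, k, connectionMatrix]
      ring
    · refine (hxder t ht).congr_deriv ?_
      simp [G, k, connectionMatrix]
      field_simp
      ring
    · refine (hyder t ht).congr_deriv ?_
      simp [G, k, connectionMatrix]
      field_simp
      ring
    · refine (hasDerivAt_const t (lam 2)).congr_deriv ?_
      simp [G, k, connectionMatrix]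
      ring

theorem generic_converse {lam mu : Fin 3 → ℂ} (hp : GenericParams lam mu)
    (c : ℂ) (r : ℝ) (x y f : ℂ → ℂ) (hr : 0 < r) (h01 : ball c r ⊆ {0, 1}ᶜ)
    (h : IsReducedSolution lam mu (ball c r) x y f) (hf0 : ∃ t ∈ ball c r, f t ≠ 0)
    (hne : ∀ t ∈ ball c r, x t ≠ 0 ∧ y t ≠ 0) :
    ∃ B : ℂ → Fin 3 → Mat,
      IsSchlesingerSolution lam mu (ball c r) B ∧
      (∀ t ∈ ball c r, coordX (B t) = x t ∧ coordY (B t) = y t ∧ coordF (B t) = f t) ∧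
      ∀ B' : ℂ → Fin 3 → Mat, IsSchlesingerSolution lam mu (ball c r) B' →
        (∀ t ∈ ball c r, coordX (B' t) = x t ∧ coordY (B' t) = y t ∧ coordF (B' t) = f t) →
        ConjugateOn (ball c r) B B' := by
  obtain ⟨B, U, V, hB, hUV⟩ := exists_schlesinger_of_reduced hp hr h01 h hf0 hne
  refine ⟨B, hB, fun t ht => ?_, fun B' hB' hB'c => ?_⟩
  · obtain ⟨hfr, hG, -⟩ := hUV t ht
    obtain ⟨nx, ny⟩ := hne t ht
    rw [hfr.coordX_eq, hfr.coordY_eq, hfr.coordF_eq, hG]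
    simp only [reducedGram, of_apply, cons_val]
    refine ⟨by ring, by ring, ?_⟩
    field_simp
    ring
  · have hc := mem_ball_self (x := c) hr
    obtain ⟨hfr, hG, hU⟩ := hUV c hc
    obtain ⟨hx, hy, hf⟩ := hB'c c hc
    obtain ⟨nx, ny⟩ := hne c hc
    obtain ⟨U₁, V₁, hf₁, hs₁, hU₁⟩ :=
      exists_frame hp.ne_zero (hB'.mem_orbit c hc) (hB'.mem_orbitInfinity c hc)
    obtain ⟨U₂, V₂, hf₂, hU₂, hG₂⟩ := hf₁.exists_reducedGram hU₁ hs₁ (by rwa [hx]) (by rwa [hy])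
    exact conjugateOn_of_gram_eq h01 hB.flow hB'.flow hfr hf₂ hU hU₂
      (by rw [hG, hG₂, hx, hy, hf])

/-! ### The chart `(η, σ)` and Painlevé VI -/

/-- The velocity of `η` in the chart `(η, σ)` of the phase space of the Schlesinger equations; the
parameters are `θ₁ = a`, `θ₂ = b`, `θ₃ = m + n - a - b`, `θ₄ = m - n`. -/
noncomputable def chartVelocity (a b m n t q s : ℂ) : ℂ :=
  2 * s + (q * (t - 1) * (1 + a - m) + (q - t) * (a + b - n - q * (m - n - 1))
    - (n - b) * (1 - q) * t) / (t * (t - 1))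

/-- The entry in row `2` and column `1` of the Gram matrix in the chart `(η, σ)`, multiplied by the
second component of the left eigenvector for `mu 2`. -/
noncomputable def chartEntry10 (a b n t q s : ℂ) : ℂ :=
  (n - a) * (q / t) - (a + b - n) * ((q - t) / (t * (t - 1))) + (n - b) * ((1 - q) / (t - 1)) - s

/-- The entry in row `3` and column `1` of the Gram matrix in the chart `(η, σ)`, multiplied by the
third component of the left eigenvector for `mu 2`. -/
noncomputable def chartEntry20 (a b n t q s : ℂ) : ℂ :=
  (a + b - n) * ((q - t) / (t * (t - 1))) - (n - b) * ((1 - q) / (t - 1)) + s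

/-- The velocity of `σ`. -/
noncomputable def chartForce (a b m n t q s : ℂ) : ℂ :=
  chartEntry20 a b n t q s * s / q
    + ((m - a) * (q / t) - s) * ((n - b) * ((1 - q) / (t - 1)) - s) / (q - t)
    + s * ((m - b) * ((1 - q) / (t - 1)) - chartEntry10 a b n t q s) / (q - 1)
    - s * (m - n - 1) * ((q - t) / (t * (t - 1)))

/-- The right hand side of the sixth Painlevé equation. -/
noncomputable def pviForce (α β γ δ t q p : ℂ) : ℂ :=
  (1 / q + 1 / (q - 1) + 1 / (q - t)) * (p ^ 2 / 2)
    - (1 / t + 1 / (t - 1) + 1 / (q - t)) * p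
    + q * (q - 1) * (q - t) / (t ^ 2 * (t - 1) ^ 2) *
      (α + β * t / q ^ 2 + γ * (t - 1) / (q - 1) ^ 2 + δ * t * (t - 1) / (q - t) ^ 2)

/-- The left side is the second derivative of `q` along the flow: the derivative of `chartVelocity`
computed in `hasDerivAt_chartVelocity`, with the velocities of `q` and `s` inserted. After clearing
denominators it is a polynomial identity. -/
theorem chartForce_eq_pviForce {a b m n t q s : ℂ} (h0 : t ≠ 0) (h1 : t - 1 ≠ 0) (hq0 : q ≠ 0)
    (hq1 : q - 1 ≠ 0) (hqt : q - t ≠ 0) :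
    2 * chartForce a b m n t q s
      + ((chartVelocity a b m n t q s * (t - 1) * (1 + a - m) + q * (1 + a - m)
        + (chartVelocity a b m n t q s - 1) * (a + b - n - q * (m - n - 1))
        - (q - t) * chartVelocity a b m n t q s * (m - n - 1)
        + (n - b) * chartVelocity a b m n t q s * t - (n - b) * (1 - q)) * (t * (t - 1))
        - (q * (t - 1) * (1 + a - m) + (q - t) * (a + b - n - q * (m - n - 1))
          - (n - b) * (1 - q) * t) * (2 * t - 1)) / (t * (t - 1)) ^ 2 =
    pviForce ((m - n - 1) ^ 2 / 2) (-a ^ 2 / 2) (b ^ 2 / 2) ((1 - (m + n - a - b) ^ 2) / 2) t q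
      (chartVelocity a b m n t q s) := by
  simp only [chartForce, chartVelocity, pviForce, chartEntry10, chartEntry20]
  field_simp
  ring

theorem hasDerivAt_chartVelocity {a b m n t q' s' : ℂ} {q s : ℂ → ℂ} (hq : HasDerivAt q q' t)
    (hs : HasDerivAt s s' t) (h0 : t ≠ 0) (h1 : t - 1 ≠ 0) :
    HasDerivAt (fun u => chartVelocity a b m n u (q u) (s u)) (2 * s'
      + ((q' * (t - 1) * (1 + a - m) + q t * (1 + a - m)
        + (q' - 1) * (a + b - n - q t * (m - n - 1))
        - (q t - t) * q' * (m - n - 1)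
        + (n - b) * q' * t - (n - b) * (1 - q t)) * (t * (t - 1))
        - (q t * (t - 1) * (1 + a - m) + (q t - t) * (a + b - n - q t * (m - n - 1))
          - (n - b) * (1 - q t) * t) * (2 * t - 1)) / (t * (t - 1)) ^ 2) t := by
  have hi := hasDerivAt_id t
  have hd1 := (hq.mul (hi.sub_const 1)).mul_const (1 + a - m)
  have hd2 := (hq.sub hi).mul ((hq.mul_const (m - n - 1)).const_sub (a + b - n))
  have hd3 := ((hq.const_sub 1).const_mul (n - b)).mul hi
  have hd4 := hi.mul (hi.sub_const 1)
  refine ((hs.const_mul 2).add (((hd1.add hd2).sub hd3).div hd4 (mul_ne_zero h0 h1))).congr_deriv ?_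
  simp only [Pi.mul_apply, Pi.sub_apply, Pi.add_apply, id]
  ring

theorem isPVISolution_of_chart {a b m n : ℂ} {U : Set ℂ} (hU : IsOpen U) (h01 : U ⊆ {0, 1}ᶜ)
    {q s : ℂ → ℂ} (hq : ∀ t ∈ U, HasDerivAt q (chartVelocity a b m n t (q t) (s t)) t)
    (hs : ∀ t ∈ U, HasDerivAt s (chartForce a b m n t (q t) (s t)) t)
    (hreg : ∀ t ∈ U, q t ≠ 0 ∧ q t ≠ 1 ∧ q t ≠ t) :
    IsPVISolution ((m - n - 1) ^ 2 / 2) (-a ^ 2 / 2) (b ^ 2 / 2) ((1 - (m + n - a - b) ^ 2) / 2)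
      U q := by
  refine ⟨fun t ht => (hq t ht).differentiableAt.differentiableWithinAt, hreg, fun t ht => ?_⟩
  have h0 : t ≠ 0 ∧ t - 1 ≠ 0 := by simpa [sub_eq_zero] using h01 ht
  obtain ⟨r0, r1, rt⟩ := hreg t ht
  have heq : deriv q =ᶠ[𝓝 t] fun u => chartVelocity a b m n u (q u) (s u) := by
    filter_upwards [hU.mem_nhds ht] with u hu using (hq u hu).deriv
  rw [heq.deriv_eq, (hasDerivAt_chartVelocity (hq t ht) (hs t ht) h0.1 h0.2).deriv,
    chartForce_eq_pviForce h0.1 h0.2 r0 (sub_ne_zero.2 r1) (sub_ne_zero.2 rt), (hq t ht).deriv,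
    pviForce]

/-- `chartVelocity` is affine in `s` with slope `2`, so `s` is read off from `q` and `q'`. The
equation for `q''` then becomes the equation for `s'`. -/
theorem IsPVISolution.exists_chart {a b m n : ℂ} {U : Set ℂ} (hU : IsOpen U) (h01 : U ⊆ {0, 1}ᶜ)
    {q : ℂ → ℂ} (h : IsPVISolution ((m - n - 1) ^ 2 / 2) (-a ^ 2 / 2) (b ^ 2 / 2)
      ((1 - (m + n - a - b) ^ 2) / 2) U q) :
    ∃ s : ℂ → ℂ, (∀ t ∈ U, HasDerivAt q (chartVelocity a b m n t (q t) (s t)) t) ∧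
      ∀ t ∈ U, HasDerivAt s (chartForce a b m n t (q t) (s t)) t := by
  let s : ℂ → ℂ := fun t => (deriv q t - chartVelocity a b m n t (q t) 0) / 2
  have hvel : ∀ t, chartVelocity a b m n t (q t) (s t) = deriv q t := fun t => by
    simp only [s, chartVelocity]
    ring
  have hq : ∀ t ∈ U, HasDerivAt q (chartVelocity a b m n t (q t) (s t)) t := fun t ht => by
    rw [hvel]
    exact (h.holo.differentiableAt (hU.mem_nhds ht)).hasDerivAt
  refine ⟨s, hq, fun t ht => ?_⟩
  have h0 : t ≠ 0 ∧ t - 1 ≠ 0 := by simpa [sub_eq_zero] using h01 ht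
  obtain ⟨r0, r1, rt⟩ := h.regular t ht
  have hdq := ((h.holo.deriv hU).differentiableAt (hU.mem_nhds ht)).hasDerivAt
  have hs := (hdq.sub (hasDerivAt_chartVelocity (a := a) (b := b) (m := m) (n := n) (hq t ht)
    (hasDerivAt_const t 0) h0.1 h0.2)).div_const 2
  have hv := hasDerivAt_chartVelocity (a := a) (b := b) (m := m) (n := n) (hq t ht) hs h0.1 h0.2
  have hv' : HasDerivAt (deriv q) _ t := hv.congr_of_eventuallyEq
    (Filter.Eventually.of_forall fun u => (hvel u).symm)
  have h2 := h.eq t ht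
  have h3 := chartForce_eq_pviForce (a := a) (b := b) (m := m) (n := n) (s := s t) h0.1 h0.2 r0
    (sub_ne_zero.2 r1) (sub_ne_zero.2 rt)
  rw [pviForce, hvel t, ← h2] at h3
  rw [hvel t] at hs
  refine hs.congr_deriv ?_
  linear_combination -h3 / 2

/-- The Gram matrix of a frame as a function of the chart coordinates, normalized by the
right eigenvector `(1, 1, 1)` for `mu 1`. -/
noncomputable def chartGram (lam mu : Fin 3 → ℂ) (t q s : ℂ) : Mat :=
  let x := s * t / q
  let y := chartEntry10 (lam 0 - mu 0) (lam 1 - mu 0) (mu 2 - mu 0) t q s * (t - 1) / (1 - q)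
  let z := ((mu 2 - lam 1) * ((1 - q) / (t - 1)) - s) * (t * (t - 1)) / (q - t)
  !![lam 0, x, mu 1 - lam 0 - x; y, lam 1, mu 1 - lam 1 - y; mu 1 - lam 2 - z, z, lam 2]

open Matrix in
theorem chartGram_mulVec (lam mu : Fin 3 → ℂ) (t q s : ℂ) :
    chartGram lam mu t q s *ᵥ (fun _ => 1) = mu 1 • fun _ => 1 := by
  ext j
  fin_cases j <;> simp [mulVec, dotProduct, Fin.sum_univ_three, chartGram]
  ring

open Matrix in
theorem vecMul_chartGram {lam mu : Fin 3 → ℂ} (h : ∑ i, lam i = ∑ i, mu i) {t q : ℂ} (s : ℂ)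
    (h0 : t ≠ 0) (h1 : t - 1 ≠ 0) (hq0 : q ≠ 0) (hq1 : q - 1 ≠ 0) (hqt : q - t ≠ 0) :
    ![q / t, (1 - q) / (t - 1), (q - t) / (t * (t - 1))] ᵥ* chartGram lam mu t q s =
      mu 2 • ![q / t, (1 - q) / (t - 1), (q - t) / (t * (t - 1))] := by
  simp only [Fin.sum_univ_three] at h
  have hq1' : 1 - q ≠ 0 := by rw [← neg_sub]; exact neg_ne_zero.2 hq1
  have hm : mu 1 = lam 0 + lam 1 + lam 2 - mu 0 - mu 2 := by linear_combination -h
  ext j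
  fin_cases j <;> simp [vecMul, dotProduct, Fin.sum_univ_three, chartGram, chartEntry10, hm] <;>
    field_simp <;> ring

open Matrix in
-- Explicit right and left eigenvectors give the eigenvalues `mu 1` and `mu 2`; the trace supplies
-- the third.
theorem isSpectral_chartGram {lam mu : Fin 3 → ℂ} (hmu : Function.Injective mu)
    (h : ∑ i, lam i = ∑ i, mu i) {t q : ℂ} (s : ℂ) (h0 : t ≠ 0) (h1 : t - 1 ≠ 0) (hq0 : q ≠ 0)
    (hq1 : q - 1 ≠ 0) (hqt : q - t ≠ 0) : IsSpectral lam mu (chartGram lam mu t q s) := by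
  have h12 : mu 1 - mu 2 ≠ 0 := sub_ne_zero.2 (hmu.ne (by decide))
  have e1 : (mu 1 • (1 : Mat) - chartGram lam mu t q s).det = 0 :=
    exists_mulVec_eq_zero_iff.1 ⟨fun _ => 1, fun h => one_ne_zero (congrFun h 0), by
      rw [sub_mulVec, chartGram_mulVec, smul_mulVec, one_mulVec, sub_self]⟩
  have e2 : (mu 2 • (1 : Mat) - chartGram lam mu t q s).det = 0 :=
    exists_vecMul_eq_zero_iff.1 ⟨![q / t, (1 - q) / (t - 1), (q - t) / (t * (t - 1))],
      fun h => div_ne_zero hq0 h0 (congrFun h 0), by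
      rw [vecMul_sub, vecMul_chartGram h s h0 h1 hq0 hq1 hqt, vecMul_smul, vecMul_one, sub_self]⟩
  simp only [Fin.sum_univ_three] at h
  have hd : ∀ i, chartGram lam mu t q s i i = lam i := fun i => by fin_cases i <;> rfl
  refine ⟨hd, fun x => ?_⟩
  have hm : mu 0 = lam 0 + lam 1 + lam 2 - mu 1 - mu 2 := by linear_combination -h
  generalize chartGram lam mu t q s = G at *
  simp [det_fin_three, hd] at e1 e2 ⊢
  -- The two monic cubics have the same trace term, so their difference has degree at most one. It
  -- vanishes at `mu 1 ≠ mu 2`, and the combination below is the interpolation formula.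
  refine mul_left_cancel₀ h12 ?_
  rw [hm]
  linear_combination (x - mu 2) * e1 - (x - mu 1) * e2

open Metric in
theorem exists_schlesinger_of_chart {lam mu : Fin 3 → ℂ} (hp : GenericParams lam mu)
    {c : ℂ} {r : ℝ} (hr : 0 < r) (h01 : ball c r ⊆ {0, 1}ᶜ) {q s : ℂ → ℂ}
    (hq : ∀ t ∈ ball c r, HasDerivAt q (chartVelocity (lam 0 - mu 0) (lam 1 - mu 0) (mu 1 - mu 0)
      (mu 2 - mu 0) t (q t) (s t)) t)
    (hs : ∀ t ∈ ball c r, HasDerivAt s (chartForce (lam 0 - mu 0) (lam 1 - mu 0) (mu 1 - mu 0)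
      (mu 2 - mu 0) t (q t) (s t)) t)
    (hreg : ∀ t ∈ ball c r, q t ≠ 0 ∧ q t ≠ 1 ∧ q t ≠ t) :
    ∃ (B : ℂ → Fin 3 → Mat) (U V : ℂ → Mat), IsSchlesingerSolution lam mu (ball c r) B ∧
      ∀ t ∈ ball c r, IsFrame (B t) (U t) (V t) ∧
        V t * U t = chartGram lam mu t (q t) (s t) ∧ IsUnit (U t) := by
  have ht0 : ∀ t ∈ ball c r, t ≠ 0 ∧ t - 1 ≠ 0 := fun t ht => by
    have := h01 ht
    simpa [sub_eq_zero] using this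
  let x : ℂ → ℂ := fun t => s t * t / q t
  let y : ℂ → ℂ := fun t =>
    chartEntry10 (lam 0 - mu 0) (lam 1 - mu 0) (mu 2 - mu 0) t (q t) (s t) * (t - 1) / (1 - q t)
  let z : ℂ → ℂ := fun t =>
    ((mu 2 - lam 1) * ((1 - q t) / (t - 1)) - s t) * (t * (t - 1)) / (q t - t)
  -- `x'`, `y'`, `z'` are the entries of `G N - N G` at `(0, 1)`, `(1, 0)`, `(2, 1)` in the gauge
  -- `k` chosen below.
  let x' : ℂ → ℂ := fun t => x t * ((mu 1 - lam 0 - x t) / t - (mu 1 - lam 1 - y t) / (t - 1))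
    + (mu 1 - lam 0 - x t) * (z t / (t - 1)) - (mu 1 - lam 0 - x t) / t * z t
  let y' : ℂ → ℂ := fun t => y t * ((mu 1 - lam 1 - y t) / (t - 1) - (mu 1 - lam 0 - x t) / t)
    + (mu 1 - lam 1 - y t) * ((mu 1 - lam 2 - z t) / t)
    - (mu 1 - lam 1 - y t) / (t - 1) * (mu 1 - lam 2 - z t)
  let z' : ℂ → ℂ := fun t => z t * ((mu 1 - lam 2 - z t) / t + z t / (t - 1)
      - (mu 1 - lam 1 - y t) / (t - 1))
    + lam 2 * (z t / (t - 1)) - z t / (t - 1) * lam 1 - (mu 1 - lam 2 - z t) / t * x t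
  have hsum := hp.sum_eq
  simp only [Fin.sum_univ_three] at hsum
  have hm : lam 2 = mu 0 + mu 1 + mu 2 - lam 0 - lam 1 := by linear_combination hsum
  have hi := fun t : ℂ => hasDerivAt_id t
  have hα : ∀ t ∈ ball c r, HasDerivAt (fun t => (1 - q t) / (t - 1)) _ t := fun t ht =>
    ((hq t ht).const_sub 1).div ((hi t).sub_const 1) (ht0 t ht).2
  have hx : ∀ t ∈ ball c r, HasDerivAt x (x' t) t := by
    intro t ht
    obtain ⟨n0, n1⟩ := ht0 t ht
    obtain ⟨r0, r1, rt⟩ := hreg t ht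
    have r1' : q t - 1 ≠ 0 := sub_ne_zero.2 r1
    have r1'' : 1 - q t ≠ 0 := sub_ne_zero.2 r1.symm
    have rt' : q t - t ≠ 0 := sub_ne_zero.2 rt
    refine (((hs t ht).mul (hi t)).div (hq t ht) r0).congr_deriv ?_
    simp only [x', x, y, z, chartForce, chartVelocity, chartEntry10, chartEntry20, id,
      Pi.mul_apply]
    field_simp
    ring
  have hy : ∀ t ∈ ball c r, HasDerivAt y (y' t) t := by
    intro t ht
    obtain ⟨n0, n1⟩ := ht0 t ht
    obtain ⟨r0, r1, rt⟩ := hreg t ht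
    have r1' : q t - 1 ≠ 0 := sub_ne_zero.2 r1
    have r1'' : 1 - q t ≠ 0 := sub_ne_zero.2 r1.symm
    have rt' : q t - t ≠ 0 := sub_ne_zero.2 rt
    have hβ := ((hi t).mul ((hi t).sub_const 1))
    have hn := (((((hq t ht).div (hi t) n0).const_mul (mu 2 - mu 0 - (lam 0 - mu 0))).sub
      ((((hq t ht).sub (hi t)).div hβ (mul_ne_zero n0 n1)).const_mul
        (lam 0 - mu 0 + (lam 1 - mu 0) - (mu 2 - mu 0)))).add
      ((hα t ht).const_mul (mu 2 - mu 0 - (lam 1 - mu 0)))).sub (hs t ht)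
    refine ((hn.mul ((hi t).sub_const 1)).div ((hq t ht).const_sub 1) r1'').congr_deriv ?_
    simp only [y', x, y, z, chartForce, chartVelocity, chartEntry10, chartEntry20, hm, id,
      Pi.mul_apply, Pi.sub_apply, Pi.add_apply, Pi.div_apply]
    field_simp
    ring
  have hz : ∀ t ∈ ball c r, HasDerivAt z (z' t) t := by
    intro t ht
    obtain ⟨n0, n1⟩ := ht0 t ht
    obtain ⟨r0, r1, rt⟩ := hreg t ht
    have r1' : q t - 1 ≠ 0 := sub_ne_zero.2 r1
    have r1'' : 1 - q t ≠ 0 := sub_ne_zero.2 r1.symm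
    have rt' : q t - t ≠ 0 := sub_ne_zero.2 rt
    have hβ := ((hi t).mul ((hi t).sub_const 1))
    have hn := ((hα t ht).const_mul (mu 2 - lam 1)).sub (hs t ht)
    refine ((hn.mul hβ).div ((hq t ht).sub (hi t)) rt').congr_deriv ?_
    simp only [z', x, y, z, chartForce, chartVelocity, chartEntry10, chartEntry20, hm, id,
      Pi.mul_apply, Pi.sub_apply]
    field_simp
    ring
  -- This gauge makes the rows of `N` sum to zero, so `(1, 1, 1)` remains an eigenvector of `G` for
  -- `mu 1`.
  let k : ℂ → Fin 3 → ℂ := fun t => ![(mu 1 - lam 0 - x t) / t, (mu 1 - lam 1 - y t) / (t - 1),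
    (mu 1 - lam 2 - z t) / t + z t / (t - 1)]
  have hG : ∀ t, chartGram lam mu t (q t) (s t) = !![lam 0, x t, mu 1 - lam 0 - x t;
    y t, lam 1, mu 1 - lam 1 - y t; mu 1 - lam 2 - z t, z t, lam 2] := fun t => rfl
  refine exists_schlesinger_of_gram hp hr h01 (k := k) ?_ ?_ fun t ht => ?_
  · have hd : ∀ {g g' : ℂ → ℂ}, (∀ t ∈ ball c r, HasDerivAt g (g' t) t) →
        DifferentiableOn ℂ g (ball c r) :=
      fun h t ht => (h t ht).differentiableAt.differentiableWithinAt
    have hi0 : DifferentiableOn ℂ (fun t : ℂ => t) (ball c r) := differentiableOn_id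
    have hi1 : DifferentiableOn ℂ (fun t : ℂ => t - 1) (ball c r) := hi0.sub_const 1
    have n0 := fun t ht => (ht0 t ht).1
    have n1 := fun t ht => (ht0 t ht).2
    intro i
    fin_cases i
    · exact ((hd hx).const_sub _).div hi0 n0
    · exact ((hd hy).const_sub _).div hi1 n1
    · exact (((hd hz).const_sub _).div hi0 n0).add ((hd hz).div hi1 n1)
  · intro t ht i j
    obtain ⟨n0, n1⟩ := ht0 t ht
    simp only [hG]
    fin_cases i <;> fin_cases j
    · refine (hasDerivAt_const t (lam 0)).congr_deriv ?_
      simp [k, connectionMatrix]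
      ring
    · refine (hx t ht).congr_deriv ?_
      simp [k, connectionMatrix, x']
      ring
    · refine ((hx t ht).const_sub _).congr_deriv ?_
      simp [k, connectionMatrix, x']
      ring
    · refine (hy t ht).congr_deriv ?_
      simp [k, connectionMatrix, y']
      ring
    · refine (hasDerivAt_const t (lam 1)).congr_deriv ?_
      simp [k, connectionMatrix]
      ring
    · refine ((hy t ht).const_sub _).congr_deriv ?_
      simp [k, connectionMatrix, y']
      ring
    · refine ((hz t ht).const_sub _).congr_deriv ?_
      simp [k, connectionMatrix, z']
      ring
    · refine (hz t ht).congr_deriv ?_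
      simp [k, connectionMatrix, z']
      ring
    · refine (hasDerivAt_const t (lam 2)).congr_deriv ?_
      simp [k, connectionMatrix]
      ring
  · obtain ⟨r0, r1, rt⟩ := hreg t ht
    exact isSpectral_chartGram hp.distinct hp.sum_eq _ (ht0 t ht).1 (ht0 t ht).2 r0
      (sub_ne_zero.2 r1) (sub_ne_zero.2 rt)

/-! ### The apparent zero and the pairings with eigenvectors -/

theorem exists_eigenvectors {mu : Fin 3 → ℂ} (hmu : Function.Injective mu) {A : Mat}
    (hA : A ∈ orbitInfinity mu) :
    ∃ w v : Fin 3 → ℂ, w ≠ 0 ∧ v ≠ 0 ∧ w ᵥ* A = (-mu 2) • w ∧ A *ᵥ v = (-mu 1) • v ∧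
      (∀ w', w' ᵥ* A = (-mu 2) • w' → ∃ k : ℂ, w' = k • w) ∧
      ∀ v', A *ᵥ v' = (-mu 1) • v' → ∃ k : ℂ, v' = k • v := by
  obtain ⟨g, rfl⟩ := hA
  have h1 : ((g⁻¹ : GL (Fin 3) ℂ) : Mat) * (g : Mat) = 1 := by
    rw [← Units.val_mul, inv_mul_cancel, Units.val_one]
  have h2 : (g : Mat) * ((g⁻¹ : GL (Fin 3) ℂ) : Mat) = 1 := by
    rw [← Units.val_mul, mul_inv_cancel, Units.val_one]
  generalize (g : Mat) = P at *
  generalize ((g⁻¹ : GL (Fin 3) ℂ) : Mat) = Q at *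
  have hdiag : ∀ (e : Fin 3 → ℂ) (l : Fin 3), (∀ i, -mu i * e i = -mu l * e i) →
      e = e l • Pi.single l 1 := by
    intro e l he
    ext i
    by_cases hi : i = l
    · subst hi; simp
    · have h0 : (mu l - mu i) * e i = 0 := by linear_combination he i
      have : e i = 0 := (mul_eq_zero.1 h0).resolve_left
        (sub_ne_zero.2 fun h => hi (hmu h.symm))
      simp [this, hi]
  have hsl : ∀ l : Fin 3, (Pi.single l 1 : Fin 3 → ℂ) ≠ 0 := fun l h => by
    simpa using congrFun h l
  refine ⟨Pi.single 2 1 ᵥ* Q, P *ᵥ Pi.single 1 1, fun h => hsl 2 ?_, fun h => hsl 1 ?_, ?_, ?_,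
    fun w' hw' => ⟨(w' ᵥ* P) 2, ?_⟩, fun v' hv' => ⟨(Q *ᵥ v') 1, ?_⟩⟩
  · have := congrArg (· ᵥ* P) h
    simpa only [vecMul_vecMul, h1, vecMul_one, zero_vecMul] using this
  · have := congrArg (Q *ᵥ ·) h
    simpa only [mulVec_mulVec, h1, one_mulVec, mulVec_zero] using this
  · rw [vecMul_vecMul, ← Matrix.mul_assoc, ← Matrix.mul_assoc, h1, Matrix.one_mul,
      ← vecMul_vecMul, ← smul_vecMul]
    congr 1
    ext i
    rw [vecMul_diagonal]
    by_cases hi : i = 2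
    · subst hi; simp
    · simp [hi]
  · rw [mulVec_mulVec, Matrix.mul_assoc, h1, Matrix.mul_one, ← mulVec_mulVec, ← mulVec_smul]
    congr 1
    ext i
    rw [mulVec_diagonal]
    by_cases hi : i = 1
    · subst hi; simp
    · simp [hi]
  · rw [← smul_vecMul, ← hdiag (w' ᵥ* P) 2, vecMul_vecMul, h2, vecMul_one]
    intro i
    have := congrFun (congrArg (· ᵥ* P) hw') i
    simp only [vecMul_vecMul, Matrix.mul_assoc, h1, Matrix.mul_one, smul_vecMul, Pi.smul_apply,
      smul_eq_mul] at this
    rw [← vecMul_vecMul, vecMul_diagonal] at this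
    rw [← this, mul_comm]
  · rw [← mulVec_smul, ← hdiag (Q *ᵥ v') 1, mulVec_mulVec, h2, one_mulVec]
    intro i
    have := congrFun (congrArg (Q *ᵥ ·) hv') i
    simp only [mulVec_mulVec, ← Matrix.mul_assoc, h1, Matrix.one_mul, mulVec_smul, Pi.smul_apply,
      smul_eq_mul] at this
    rw [← mulVec_mulVec, mulVec_diagonal] at this
    exact this

/-- A left eigenvector and a right eigenvector of the residue at infinity, for the eigenvalues used
in the definition of the apparent zero. -/
structure IsEigenPair (mu : Fin 3 → ℂ) (A : Mat) (w v : Fin 3 → ℂ) : Prop where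
  left_ne : w ≠ 0
  right_ne : v ≠ 0
  left : w ᵥ* A = (-mu 2) • w
  right : A *ᵥ v = (-mu 1) • v

theorem IsEigenPair.dotProduct_eq_zero {mu : Fin 3 → ℂ} (hmu : Function.Injective mu) {A : Mat}
    {w v : Fin 3 → ℂ} (h : IsEigenPair mu A w v) : w ⬝ᵥ v = 0 := by
  have h1 : w ⬝ᵥ (A *ᵥ v) = (w ᵥ* A) ⬝ᵥ v := dotProduct_mulVec w A v
  rw [h.left, h.right, dotProduct_smul, smul_dotProduct, smul_eq_mul, smul_eq_mul] at h1
  have h2 : (mu 2 - mu 1) * (w ⬝ᵥ v) = 0 := by linear_combination h1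
  exact (mul_eq_zero.1 h2).resolve_left (sub_ne_zero.2 (hmu.ne (by decide)))

/-- The pairing of the residue `B i` with an eigenpair. -/
def pairing (w v : Fin 3 → ℂ) (A : Mat) : ℂ := w ⬝ᵥ (A *ᵥ v)

theorem pairing_add (w v : Fin 3 → ℂ) (A A' : Mat) :
    pairing w v (A + A') = pairing w v A + pairing w v A' := by
  rw [pairing, add_mulVec, dotProduct_add]; rfl

theorem pairing_sub (w v : Fin 3 → ℂ) (A A' : Mat) :
    pairing w v (A - A') = pairing w v A - pairing w v A' := by
  rw [pairing, sub_mulVec, dotProduct_sub]; rfl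

theorem pairing_smul (w v : Fin 3 → ℂ) (k : ℂ) (A : Mat) :
    pairing w v (k • A) = k * pairing w v A := by
  rw [pairing, smul_mulVec, dotProduct_smul]; rfl

/-- Eigenvectors for different eigenvalues are orthogonal, so the residue at infinity pairs to zero.
This makes the entry of the cleared system linear in `z`. -/
theorem IsEigenPair.sum_pairing {mu : Fin 3 → ℂ} (hmu : Function.Injective mu) {B : Fin 3 → Mat}
    {w v : Fin 3 → ℂ} (h : IsEigenPair mu (resInfinity B) w v) :
    pairing w v (B 0) + pairing w v (B 1) + pairing w v (B 2) = 0 := by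
  have h1 : pairing w v (resInfinity B) = 0 := by
    rw [pairing, h.right, dotProduct_smul, h.dotProduct_eq_zero hmu, smul_zero]
  rw [resInfinity, ← neg_one_smul ℂ, pairing_smul, pairing_add, pairing_add] at h1
  linear_combination -h1

theorem pairing_clearedSystem (w v : Fin 3 → ℂ) (B : Fin 3 → Mat) (t z : ℂ) :
    w ⬝ᵥ (clearedSystem B t z *ᵥ v) = (z - 1) * (z - t) * pairing w v (B 0)
      + z * (z - t) * pairing w v (B 1) + z * (z - 1) * pairing w v (B 2) := by
  change pairing w v _ = _
  rw [clearedSystem, pairing_add, pairing_add, pairing_smul, pairing_smul, pairing_smul]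

/-- The leading coefficient, up to sign, of the entry defining the apparent zero. -/
def leadingCoeff (w v : Fin 3 → ℂ) (B : Fin 3 → Mat) (t : ℂ) : ℂ :=
  t * pairing w v (B 0) + (t - 1) * pairing w v (B 1)

/-- The entry is `t (w B_0 v) - c z` with `c` the leading coefficient, so a unique zero exists
exactly when `c ≠ 0`. The eigenvalues are simple, so another eigenpair only rescales it. -/
theorem IsEigenPair.isApparentZero_iff {mu : Fin 3 → ℂ} (hmu : Function.Injective mu)
    {B : Fin 3 → Mat} {w v : Fin 3 → ℂ} (h : IsEigenPair mu (resInfinity B) w v)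
    (hB : resInfinity B ∈ orbitInfinity mu) (t q : ℂ) :
    IsApparentZero mu B t q ↔
      leadingCoeff w v B t ≠ 0 ∧ leadingCoeff w v B t * q = t * pairing w v (B 0) := by
  have hsum := h.sum_pairing hmu
  have hlin : ∀ z, w ⬝ᵥ (clearedSystem B t z *ᵥ v) =
      t * pairing w v (B 0) - leadingCoeff w v B t * z := by
    intro z
    rw [pairing_clearedSystem, leadingCoeff]
    linear_combination (z * (z - 1)) * hsum
  constructor
  · rintro ⟨w', v', hw0, hv0, hw, hv, hz⟩
    obtain ⟨w₀, v₀, -, -, -, -, hwu, hvu⟩ := exists_eigenvectors hmu hB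
    obtain ⟨k₁, rfl⟩ := hwu w' hw
    obtain ⟨k₂, hk₂⟩ := hwu w h.left
    obtain ⟨l₁, rfl⟩ := hvu v' hv
    obtain ⟨l₂, hl₂⟩ := hvu v h.right
    have nk₁ : k₁ ≠ 0 := fun h0 => hw0 (by rw [h0, zero_smul])
    have nl₁ : l₁ ≠ 0 := fun h0 => hv0 (by rw [h0, zero_smul])
    have nk₂ : k₂ ≠ 0 := fun h0 => h.left_ne (by rw [hk₂, h0, zero_smul])
    have nl₂ : l₂ ≠ 0 := fun h0 => h.right_ne (by rw [hl₂, h0, zero_smul])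
    have hz' : ∀ z, w ⬝ᵥ (clearedSystem B t z *ᵥ v) = 0 ↔ z = q := by
      intro z
      rw [← hz z, hk₂, hl₂]
      simp [mulVec_smul, nk₁, nk₂, nl₁, nl₂]
    simp only [hlin] at hz'
    have hq := (hz' q).2 rfl
    refine ⟨fun h0 => ?_, by linear_combination -hq⟩
    -- If `c` vanished, a zero at `q` would make the entry vanish at `q + 1` as well.
    have h1 := (hz' (q + 1)).1 (by rw [h0] at hq ⊢; linear_combination hq)
    simp at h1
  · rintro ⟨hc, hq⟩
    refine ⟨w, v, h.left_ne, h.right_ne, h.left, h.right, fun z => ?_⟩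
    rw [hlin, ← hq, ← mul_sub, mul_eq_zero, or_iff_right hc, sub_eq_zero, eq_comm]

/-- The coordinates of the residues in terms of the apparent zero. -/
theorem IsEigenPair.pairing_eq {mu : Fin 3 → ℂ} (hmu : Function.Injective mu)
    {B : Fin 3 → Mat} {w v : Fin 3 → ℂ} (h : IsEigenPair mu (resInfinity B) w v) {t q : ℂ}
    (h0 : t ≠ 0) (h1 : t - 1 ≠ 0)
    (hq : leadingCoeff w v B t * q = t * pairing w v (B 0)) :
    pairing w v (B 0) = leadingCoeff w v B t * (q / t) ∧
    pairing w v (B 1) = leadingCoeff w v B t * ((1 - q) / (t - 1)) ∧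
    pairing w v (B 2) = leadingCoeff w v B t * ((q - t) / (t * (t - 1))) := by
  have hsum := h.sum_pairing hmu
  have hc : leadingCoeff w v B t = t * pairing w v (B 0) + (t - 1) * pairing w v (B 1) := rfl
  have e0 : pairing w v (B 0) = leadingCoeff w v B t * (q / t) := by
    field_simp; linear_combination -hq
  have e1 : pairing w v (B 1) = leadingCoeff w v B t * ((1 - q) / (t - 1)) := by
    field_simp; linear_combination hq - hc
  refine ⟨e0, e1, ?_⟩
  have : pairing w v (B 2) = -pairing w v (B 0) - pairing w v (B 1) := by
    linear_combination hsum
  rw [this, e0, e1]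
  field_simp
  ring

section Frame

variable {B : Fin 3 → Mat} {U V : Mat} {w v : Fin 3 → ℂ}

theorem IsFrame.pairing_eq (h : IsFrame B U V) (i : Fin 3) :
    pairing w v (B i) = (w ᵥ* U) i * (V *ᵥ v) i := h.bilin_eq w v i

theorem IsFrame.pairing_mul (h : IsFrame B U V) (i j : Fin 3) :
    pairing w v (B i * B j) = (w ᵥ* U) i * (V * U) i j * (V *ᵥ v) j := by
  rw [h.mul_eq, pairing_smul, pairing, vecMulVec_mulVec]
  simp [dotProduct, vecMul, mulVec, Fin.sum_univ_three]
  ring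

/-- Because `B j` has rank one, the triple product splits at `j`. This closes the evolution of `w
B_0 B_1 v` in terms of double products. -/
theorem IsFrame.pairing_mul_mul (h : IsFrame B U V) (i j k : Fin 3) :
    pairing w v (B i * B j * B k) * pairing w v (B j) =
      pairing w v (B i * B j) * pairing w v (B j * B k) := by
  have : B i * B j * B k = ((V * U) i j * (V * U) j k) • vecMulVec (fun a => U a i) (V k) := by
    rw [h.mul_eq i j, Matrix.smul_mul, h k, vecMulVec_mul_vecMulVec]
    ext a b
    simp [vecMulVec_apply, dotProduct, mul_apply, Fin.sum_univ_three]
    ring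
  rw [this, h.pairing_mul, h.pairing_mul, h.pairing_eq, pairing_smul, pairing, vecMulVec_mulVec]
  simp [dotProduct, vecMul, mulVec, Fin.sum_univ_three]
  ring

theorem IsFrame.row_sum {mu : Fin 3 → ℂ} (h : IsFrame B U V)
    (he : IsEigenPair mu (resInfinity B) w v) (i : Fin 3) :
    (V * U) i 0 * (V *ᵥ v) 0 + (V * U) i 1 * (V *ᵥ v) 1 + (V * U) i 2 * (V *ᵥ v) 2 =
      mu 1 * (V *ᵥ v) i := by
  have h1 := he.right
  rw [resInfinity, h.sum_eq, neg_mulVec, neg_smul, neg_inj] at h1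
  have h2 : (V * U) *ᵥ (V *ᵥ v) = mu 1 • (V *ᵥ v) := by
    rw [← mulVec_smul, ← h1, mulVec_mulVec, mulVec_mulVec, Matrix.mul_assoc]
  have := congrFun h2 i
  rw [mulVec, dotProduct, Fin.sum_univ_three] at this
  exact this

theorem IsFrame.col_sum {mu : Fin 3 → ℂ} (h : IsFrame B U V)
    (he : IsEigenPair mu (resInfinity B) w v) (j : Fin 3) :
    (w ᵥ* U) 0 * (V * U) 0 j + (w ᵥ* U) 1 * (V * U) 1 j + (w ᵥ* U) 2 * (V * U) 2 j =
      mu 2 * (w ᵥ* U) j := by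
  have h1 := he.left
  rw [resInfinity, h.sum_eq, vecMul_neg, neg_smul, neg_inj] at h1
  have h2 : (w ᵥ* U) ᵥ* (V * U) = mu 2 • (w ᵥ* U) := by
    rw [← smul_vecMul, ← h1, vecMul_vecMul, vecMul_vecMul, Matrix.mul_assoc]
  have := congrFun h2 j
  rw [vecMul, dotProduct, Fin.sum_univ_three] at this
  exact this

/-- `V v` and `w U` are right and left eigenvectors of the Gram matrix. Their equations express the
other five mixed products `w B_i B_j v` through `w B_0 B_1 v` and the `w B_i v`. -/
theorem IsFrame.pairing_relations {lam mu : Fin 3 → ℂ} (h : IsFrame B U V)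
    (hs : IsSpectral lam mu (V * U)) (he : IsEigenPair mu (resInfinity B) w v) :
    pairing w v (B 0 * B 2) = (mu 1 - lam 0) * pairing w v (B 0) - pairing w v (B 0 * B 1) ∧
    pairing w v (B 2 * B 1) = (mu 2 - lam 1) * pairing w v (B 1) - pairing w v (B 0 * B 1) ∧
    pairing w v (B 2 * B 0) = (mu 1 - lam 2) * pairing w v (B 2) - pairing w v (B 2 * B 1) ∧
    pairing w v (B 1 * B 0) = (mu 2 - lam 0) * pairing w v (B 0) - pairing w v (B 2 * B 0) ∧
    pairing w v (B 1 * B 2) = (mu 1 - lam 1) * pairing w v (B 1) - pairing w v (B 1 * B 0) := by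
  have r := h.row_sum he
  have c := h.col_sum he
  have r0 := r 0
  have r1 := r 1
  have r2 := r 2
  have c0 := c 0
  have c1 := c 1
  simp only [h.pairing_mul, h.pairing_eq]
  rw [hs.diag] at r0 r1 r2 c0 c1
  refine ⟨?_, ?_, ?_, ?_, ?_⟩
  · linear_combination (w ᵥ* U) 0 * r0
  · linear_combination (V *ᵥ v) 1 * c1
  · linear_combination (w ᵥ* U) 2 * r2
  · linear_combination (V *ᵥ v) 0 * c0
  · linear_combination (w ᵥ* U) 1 * r1

theorem IsFrame.exists_chartGram {lam mu : Fin 3 → ℂ} (hp : GenericParams lam mu)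
    (h : IsFrame B U V) (hU : IsUnit U)
    (hs : IsSpectral lam mu (V * U)) (he : IsEigenPair mu (resInfinity B) w v) {t q : ℂ}
    (h0 : t ≠ 0) (h1 : t - 1 ≠ 0) (hq0 : q ≠ 0) (hq1 : q ≠ 1) (hqt : q ≠ t)
    (hc : leadingCoeff w v B t ≠ 0)
    (hq : leadingCoeff w v B t * q = t * pairing w v (B 0)) :
    ∃ U' V' : Mat, IsFrame B U' V' ∧ IsUnit U' ∧ V' * U' =
      chartGram lam mu t q (pairing w v (B 0 * B 1) / leadingCoeff w v B t) := by
  obtain ⟨e0, e1, e2⟩ := he.pairing_eq hp.distinct h0 h1 hq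
  obtain ⟨r02, r21, r20, r10, r12⟩ := h.pairing_relations hs he
  have hq1' : 1 - q ≠ 0 := sub_ne_zero.2 hq1.symm
  have hqt' : q - t ≠ 0 := sub_ne_zero.2 hqt
  have hsum := hp.sum_eq
  simp only [Fin.sum_univ_three] at hsum
  have hm : lam 2 = mu 0 + mu 1 + mu 2 - lam 0 - lam 1 := by linear_combination hsum
  have hne : ∀ i, pairing w v (B i) ≠ 0 := by
    intro i
    fin_cases i
    · exact e0 ▸ mul_ne_zero hc (div_ne_zero hq0 h0)
    · exact e1 ▸ mul_ne_zero hc (div_ne_zero hq1' h1)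
    · exact e2 ▸ mul_ne_zero hc (div_ne_zero hqt' (mul_ne_zero h0 h1))
  have hne' : ∀ i, (w ᵥ* U) i ≠ 0 ∧ (V *ᵥ v) i ≠ 0 := fun i => by
    have := hne i
    rwa [h.pairing_eq, mul_ne_zero_iff] at this
  -- Scaling by `V v` turns the right eigenvector of the Gram matrix into `(1, 1, 1)`, the
  -- normalization of `chartGram`.
  obtain ⟨U', V', hf', hU', hG'⟩ := h.exists_rescaled hU (d := V *ᵥ v) fun i => (hne' i).2
  refine ⟨U', V', hf', hU', ?_⟩
  have hG : ∀ i j, (V' * U') i j = pairing w v (B i * B j) / pairing w v (B i) := by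
    intro i j
    have := (hne' i).1
    have := (hne' i).2
    rw [hG', h.pairing_mul, h.pairing_eq]
    field_simp
  have hdiag : ∀ i, (V' * U') i i = lam i := fun i => by
    have := (hne' i).2
    rw [hG', hs.diag]
    field_simp
  ext i j
  fin_cases i <;> fin_cases j
  · exact hdiag 0
  · change (V' * U') 0 1 = _
    rw [hG, e0]
    simp only [chartGram, of_apply, cons_val, Fin.zero_eta, Fin.mk_one]
    field_simp
  · change (V' * U') 0 2 = _
    rw [hG, r02, e0]
    simp [chartGram]
    field_simp
  · change (V' * U') 1 0 = _
    rw [hG, r10, r20, r21, e0, e1, e2]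
    simp [chartGram, chartEntry10, hm]
    field_simp
    ring
  · exact hdiag 1
  · change (V' * U') 1 2 = _
    rw [hG, r12, r10, r20, r21, e0, e1, e2]
    simp [chartGram, chartEntry10, hm]
    field_simp
    ring
  · change (V' * U') 2 0 = _
    rw [hG, r20, r21, e1, e2]
    simp [chartGram]
    field_simp
  · change (V' * U') 2 1 = _
    rw [hG, r21, e1, e2]
    simp [chartGram]
    field_simp
  · exact hdiag 2

end Frame

theorem pairing_lie (w v : Fin 3 → ℂ) (X Y : Mat) :
    pairing w v ⁅X, Y⁆ = pairing w v (X * Y) - pairing w v (Y * X) := by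
  rw [Ring.lie_def, pairing_sub]

theorem HasEntryDerivAt.pairing {A : ℂ → Mat} {A' : Mat} {t : ℂ} (h : HasEntryDerivAt A A' t)
    (w v : Fin 3 → ℂ) : HasDerivAt (fun s => pairing w v (A s)) (pairing w v A') t :=
  h.bilin w v

/-- The evolution of the chart coordinates along a Schlesinger solution. -/
theorem IsSchlesingerSolution.hasDerivAt_chart {lam mu : Fin 3 → ℂ} (hp : GenericParams lam mu)
    {U : Set ℂ} (hU : IsOpen U) (h01 : U ⊆ {0, 1}ᶜ) {B : ℂ → Fin 3 → Mat}
    (hB : IsSchlesingerSolution lam mu U B) {w v : Fin 3 → ℂ} {q : ℂ → ℂ}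
    (he : ∀ t ∈ U, IsEigenPair mu (resInfinity (B t)) w v)
    (hq : ∀ t ∈ U, leadingCoeff w v (B t) t ≠ 0 ∧
      leadingCoeff w v (B t) t * q t = t * pairing w v (B t 0))
    (hreg : ∀ t ∈ U, q t ≠ 0 ∧ q t ≠ 1 ∧ q t ≠ t) {t : ℂ} (ht : t ∈ U) :
    HasDerivAt q (chartVelocity (lam 0 - mu 0) (lam 1 - mu 0) (mu 1 - mu 0) (mu 2 - mu 0) t (q t)
      (pairing w v (B t 0 * B t 1) / leadingCoeff w v (B t) t)) t ∧
    HasDerivAt (fun t => pairing w v (B t 0 * B t 1) / leadingCoeff w v (B t) t)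
      (chartForce (lam 0 - mu 0) (lam 1 - mu 0) (mu 1 - mu 0) (mu 2 - mu 0) t (q t)
        (pairing w v (B t 0 * B t 1) / leadingCoeff w v (B t) t)) t := by
  have hf := hB.flow
  obtain ⟨h0, h1⟩ : t ≠ 0 ∧ t - 1 ≠ 0 := by simpa [sub_eq_zero] using h01 ht
  obtain ⟨hc, hqt⟩ := hq t ht
  obtain ⟨r0, r1, rt⟩ := hreg t ht
  have r1' : q t - 1 ≠ 0 := sub_ne_zero.2 r1
  have r1'' : 1 - q t ≠ 0 := sub_ne_zero.2 r1.symm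
  have rt' : q t - t ≠ 0 := sub_ne_zero.2 rt
  have hsum := hp.sum_eq
  simp only [Fin.sum_univ_three] at hsum
  have hm : lam 2 = mu 0 + mu 1 + mu 2 - lam 0 - lam 1 := by linear_combination hsum
  obtain ⟨P, Q, hfr, hs, -⟩ := exists_frame hp.ne_zero (hB.mem_orbit t ht) (hB.mem_orbitInfinity t ht)
  obtain ⟨r02, r21, r20, r10, r12⟩ := hfr.pairing_relations hs (he t ht)
  obtain ⟨e0, e1, e2⟩ := (he t ht).pairing_eq hp.distinct h0 h1 hqt
  have n0 : pairing w v (B t 0) ≠ 0 := e0 ▸ mul_ne_zero hc (div_ne_zero r0 h0)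
  have n1 : pairing w v (B t 1) ≠ 0 := e1 ▸ mul_ne_zero hc (div_ne_zero r1'' h1)
  have n2 : pairing w v (B t 2) ≠ 0 := e2 ▸ mul_ne_zero hc (div_ne_zero rt' (mul_ne_zero h0 h1))
  -- Only these three triple products occur in the derivative of `w B_0 B_1 v`. Their denominators
  -- produce the factors `q`, `q - t` and `q - 1` in `chartForce`.
  have t201 := eq_div_of_mul_eq n0 (hfr.pairing_mul_mul (w := w) (v := v) 2 0 1)
  have t021 := eq_div_of_mul_eq n2 (hfr.pairing_mul_mul (w := w) (v := v) 0 2 1)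
  have t012 := eq_div_of_mul_eq n1 (hfr.pairing_mul_mul (w := w) (v := v) 0 1 2)
  have d0 := (hf.zero t ht).pairing w v
  have d1 := (hf.one t ht).pairing w v
  have d01 := ((hf.zero t ht).mul (hf.one t ht)).pairing w v
  have hX : ∀ X Y Z : Mat, pairing w v (⁅X, Y⁆ * Z) =
      pairing w v (X * Y * Z) - pairing w v (Y * X * Z) := fun X Y Z => by
    rw [Ring.lie_def, Matrix.sub_mul, pairing_sub]
  have hX' : ∀ X Y Z : Mat, pairing w v (Z * ⁅X, Y⁆) =
      pairing w v (Z * X * Y) - pairing w v (Z * Y * X) := fun X Y Z => by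
    rw [Ring.lie_def, Matrix.mul_sub, pairing_sub, Matrix.mul_assoc, Matrix.mul_assoc]
  simp only [pairing_add, Matrix.smul_mul, Matrix.mul_smul, pairing_smul, pairing_lie, hX, hX']
    at d0 d1 d01
  rw [t201, t021, t012] at d01
  have dc : HasDerivAt (fun t => leadingCoeff w v (B t) t) _ t :=
    ((hasDerivAt_id t).mul d0).add (((hasDerivAt_id t).sub_const 1).mul d1)
  have dq : HasDerivAt q _ t := (((hasDerivAt_id t).mul d0).div dc hc).congr_of_eventuallyEq <| by
    filter_upwards [hU.mem_nhds ht] with u hu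
    rw [Pi.div_apply, eq_div_iff (hq u hu).1, mul_comm, (hq u hu).2]
    rfl
  refine ⟨dq.congr_deriv ?_, (d01.div dc hc).congr_deriv ?_⟩
  · simp only [id, Pi.mul_apply]
    rw [r02, r12, r10, r20, r21, e0, e1, e2, hm]
    simp only [chartVelocity]
    generalize leadingCoeff w v (B t) t = c at *
    generalize RankThree.pairing w v (B t 0 * B t 1) = H at *
    field_simp
    ring
  · simp only [id]
    rw [r02, r12, r10, r20, r21, e0, e1, e2, hm]
    simp only [chartForce, chartEntry10, chartEntry20]
    generalize leadingCoeff w v (B t) t = c at *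
    generalize RankThree.pairing w v (B t 0 * B t 1) = H at *
    field_simp
    ring

theorem IsSchlesingerFlow.resInfinity_eq {B : ℂ → Fin 3 → Mat} {c : ℂ} {r : ℝ} (hr : 0 < r)
    (h : IsSchlesingerFlow (ball c r) B) {t : ℂ} (ht : t ∈ ball c r) :
    resInfinity (B t) = resInfinity (B c) := by
  have hd : ∀ t ∈ ball c r, HasEntryDerivAt (fun s => resInfinity (B s)) 0 t := fun t ht =>
    (((h.zero t ht).add (h.one t ht)).add (h.two t ht)).neg.congr_deriv (by
      simp only [Ring.lie_def, smul_sub]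
      abel)
  ext i j
  exact isOpen_ball.is_const_of_deriv_eq_zero (𝕜 := ℂ) (f := fun s => resInfinity (B s) i j)
    (convex_ball c r).isPreconnected
    (fun s hs => (hd s hs i j).differentiableAt.differentiableWithinAt)
    (fun s hs => (hd s hs i j).deriv) ht (mem_ball_self hr)

theorem IsSchlesingerSolution.exists_eigenPair {lam mu : Fin 3 → ℂ} (hp : GenericParams lam mu)
    {B : ℂ → Fin 3 → Mat} {c : ℂ} {r : ℝ} (hr : 0 < r)
    (h : IsSchlesingerSolution lam mu (ball c r) B) :
    ∃ w v, ∀ t ∈ ball c r, IsEigenPair mu (resInfinity (B t)) w v := by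
  obtain ⟨w, v, hw, hv, hl, hR, -, -⟩ :=
    exists_eigenvectors hp.distinct (h.mem_orbitInfinity c (mem_ball_self hr))
  exact ⟨w, v, fun t ht => by rw [h.flow.resInfinity_eq hr ht]; exact ⟨hw, hv, hl, hR⟩⟩

theorem isAssociatedPVISolution_iff {lam mu : Fin 3 → ℂ} (hp : GenericParams lam mu) {U : Set ℂ}
    {η : ℂ → ℂ} : IsAssociatedPVISolution lam mu U η ↔
      IsPVISolution ((mu 1 - mu 0 - (mu 2 - mu 0) - 1) ^ 2 / 2) (-(lam 0 - mu 0) ^ 2 / 2)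
        ((lam 1 - mu 0) ^ 2 / 2)
        ((1 - (mu 1 - mu 0 + (mu 2 - mu 0) - (lam 0 - mu 0) - (lam 1 - mu 0)) ^ 2) / 2) U η := by
  have hsum := hp.sum_eq
  simp only [Fin.sum_univ_three] at hsum
  have hm : lam 2 = mu 0 + mu 1 + mu 2 - lam 0 - lam 1 := by linear_combination hsum
  have e1 : mu 1 - mu 0 - (mu 2 - mu 0) - 1 = mu 1 - mu 2 - 1 := by ring
  have e2 : mu 1 - mu 0 + (mu 2 - mu 0) - (lam 0 - mu 0) - (lam 1 - mu 0) = lam 2 - mu 0 := by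
    rw [hm]; ring
  rw [e1, e2]
  rfl

theorem isAssociatedPVISolution_of_schlesinger {lam mu : Fin 3 → ℂ} (hp : GenericParams lam mu)
    {U : Set ℂ} {B : ℂ → Fin 3 → Mat} {η : ℂ → ℂ} (hU : IsOpen U) (h01 : U ⊆ {0, 1}ᶜ)
    (hB : IsSchlesingerSolution lam mu U B)
    (hη : ∀ t ∈ U, IsApparentZero mu (B t) t (η t) ∧ η t ≠ 0 ∧ η t ≠ 1 ∧ η t ≠ t) :
    IsAssociatedPVISolution lam mu U η := by
  -- The residue at infinity is constant on a disc, so one eigenpair serves there; Painlevé VI and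
  -- holomorphy are local.
  have hloc : ∀ c ∈ U, ∃ r > 0, ball c r ⊆ U ∧ IsAssociatedPVISolution lam mu (ball c r) η := by
    intro c hc
    obtain ⟨r, hr, hrU⟩ := Metric.isOpen_iff.1 hU c hc
    have hB' := hB.mono hrU
    obtain ⟨w, v, he⟩ := hB'.exists_eigenPair hp hr
    have hq := fun t (ht : t ∈ ball c r) => ((he t ht).isApparentZero_iff hp.distinct
      (hB'.mem_orbitInfinity t ht) t (η t)).1 (hη t (hrU ht)).1
    have hreg := fun t (ht : t ∈ ball c r) => (hη t (hrU ht)).2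
    refine ⟨r, hr, hrU, (isAssociatedPVISolution_iff hp).2 ?_⟩
    exact isPVISolution_of_chart isOpen_ball (hrU.trans h01)
      (fun t ht => (hB'.hasDerivAt_chart hp isOpen_ball (hrU.trans h01) he hq hreg ht).1)
      (fun t ht => (hB'.hasDerivAt_chart hp isOpen_ball (hrU.trans h01) he hq hreg ht).2) hreg
  refine ⟨fun t ht => ?_, fun t ht => (hη t ht).2, fun t ht => ?_⟩ <;>
    obtain ⟨r, hr, -, h⟩ := hloc t ht
  · exact (h.holo.differentiableAt (ball_mem_nhds t hr)).differentiableWithinAt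
  · exact h.eq t (mem_ball_self hr)

/-- `V` and `U` carry the eigenvectors of `V * U` to eigenvectors of `U * V`. Against these, `B i`
pairs to `mu 1 * mu 2 * α i`, and the leading coefficient is `mu 1 * mu 2`, which is nonzero. -/
theorem IsFrame.isApparentZero_of_chartGram {lam mu : Fin 3 → ℂ} (hp : GenericParams lam mu)
    {B : Fin 3 → Mat} {U V : Mat} (hf : IsFrame B U V)
    (hB : resInfinity B ∈ orbitInfinity mu) {t q s : ℂ} (h0 : t ≠ 0) (h1 : t - 1 ≠ 0)
    (hq0 : q ≠ 0) (hq1 : q ≠ 1) (hqt : q ≠ t) (hG : V * U = chartGram lam mu t q s) :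
    IsApparentZero mu B t q := by
  let α : Fin 3 → ℂ := ![q / t, (1 - q) / (t - 1), (q - t) / (t * (t - 1))]
  let e : Fin 3 → ℂ := fun _ => 1
  have hr : (V * U) *ᵥ e = mu 1 • e := by rw [hG]; exact chartGram_mulVec lam mu t q s
  have hl : α ᵥ* (V * U) = mu 2 • α := by
    rw [hG]
    exact vecMul_chartGram hp.sum_eq s h0 h1 hq0 (sub_ne_zero.2 hq1) (sub_ne_zero.2 hqt)
  have hα : α ≠ 0 := fun h => div_ne_zero hq0 h0 (congrFun h 0)
  have he : e ≠ 0 := fun h => one_ne_zero (congrFun h 0)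
  have hVv : V *ᵥ (U *ᵥ e) = mu 1 • e := by rw [mulVec_mulVec, hr]
  have hwU : (α ᵥ* V) ᵥ* U = mu 2 • α := by rw [vecMul_vecMul, hl]
  have hpair : IsEigenPair mu (resInfinity B) (α ᵥ* V) (U *ᵥ e) := by
    refine ⟨fun h => ?_, fun h => ?_, ?_, ?_⟩
    · rw [h, zero_vecMul] at hwU
      exact smul_ne_zero (hp.ne_zero 2) hα hwU.symm
    · rw [h, mulVec_zero] at hVv
      exact smul_ne_zero (hp.ne_zero 1) he hVv.symm
    · rw [resInfinity, hf.sum_eq, vecMul_neg, ← vecMul_vecMul, hwU, smul_vecMul, neg_smul]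
    · rw [resInfinity, hf.sum_eq, neg_mulVec, ← mulVec_mulVec, hVv, mulVec_smul, neg_smul]
  have hval : ∀ i, pairing (α ᵥ* V) (U *ᵥ e) (B i) = mu 1 * mu 2 * α i := fun i => by
    rw [hf.pairing_eq, hwU, hVv]
    simp [e]
    ring
  have hc : leadingCoeff (α ᵥ* V) (U *ᵥ e) B t = mu 1 * mu 2 := by
    rw [leadingCoeff, hval, hval]
    simp only [α, cons_val]
    field_simp
    ring
  rw [hpair.isApparentZero_iff hp.distinct hB, hc, hval]
  refine ⟨mul_ne_zero (hp.ne_zero 1) (hp.ne_zero 2), ?_⟩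
  simp only [α, cons_val]
  field_simp

theorem exists_schlesinger_of_pvi {lam mu : Fin 3 → ℂ} (hp : GenericParams lam mu)
    (c : ℂ) (r : ℝ) (η : ℂ → ℂ) (hr : 0 < r) (h01 : ball c r ⊆ {0, 1}ᶜ)
    (hη : IsAssociatedPVISolution lam mu (ball c r) η) :
    ∃ B : ℂ → Fin 3 → Mat, IsSchlesingerSolution lam mu (ball c r) B ∧
      (∀ t ∈ ball c r, IsApparentZero mu (B t) t (η t)) ∧
      ∀ B' : ℂ → Fin 3 → Mat, IsSchlesingerSolution lam mu (ball c r) B' →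
        (∀ t ∈ ball c r, IsApparentZero mu (B' t) t (η t)) → ConjugateOn (ball c r) B B' := by
  have hη' := (isAssociatedPVISolution_iff hp).1 hη
  obtain ⟨s, hq, hs⟩ := hη'.exists_chart isOpen_ball h01
  obtain ⟨B, U, V, hB, hUV⟩ := exists_schlesinger_of_chart hp hr h01 hq hs hη.regular
  refine ⟨B, hB, fun t ht => ?_, fun B' hB' hB'η => ?_⟩
  · obtain ⟨hfr, hG, -⟩ := hUV t ht
    obtain ⟨r0, r1, rt⟩ := hη.regular t ht
    obtain ⟨h0, h1⟩ : t ≠ 0 ∧ t - 1 ≠ 0 := by simpa [sub_eq_zero] using h01 ht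
    exact hfr.isApparentZero_of_chartGram hp (hB.mem_orbitInfinity t ht) h0 h1 r0 r1 rt hG
  · have hc := mem_ball_self (x := c) hr
    obtain ⟨w, v, he⟩ := hB'.exists_eigenPair hp hr
    have hq' := fun t (ht : t ∈ ball c r) => ((he t ht).isApparentZero_iff hp.distinct
      (hB'.mem_orbitInfinity t ht) t (η t)).1 (hB'η t ht)
    have hder := (hB'.hasDerivAt_chart hp isOpen_ball h01 he hq' hη.regular hc).1
    -- Both solutions have the same `η`, hence the same `η'` at `c`, and this determines `σ`.
    have hsc : pairing w v (B' c 0 * B' c 1) / leadingCoeff w v (B' c) c = s c := by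
      have := hder.unique (hq c hc)
      simp only [chartVelocity] at this
      linear_combination this / 2
    obtain ⟨hfr, hG, hU⟩ := hUV c hc
    obtain ⟨r0, r1, rt⟩ := hη.regular c hc
    obtain ⟨U₁, V₁, hf₁, hs₁, hU₁⟩ :=
      exists_frame hp.ne_zero (hB'.mem_orbit c hc) (hB'.mem_orbitInfinity c hc)
    obtain ⟨h0, h1⟩ : c ≠ 0 ∧ c - 1 ≠ 0 := by simpa [sub_eq_zero] using h01 hc
    obtain ⟨U₂, V₂, hf₂, hU₂, hG₂⟩ := hf₁.exists_chartGram hp hU₁ hs₁ (he c hc) h0 h1 r0 r1 rt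
      (hq' c hc).1 (hq' c hc).2
    exact conjugateOn_of_gram_eq h01 hB.flow hB'.flow hfr hf₂ hU hU₂ (by rw [hG, hG₂, hsc])

/-! ### Irreducibility and regularity of the apparent zero -/

section Reducible

variable {lam mu : Fin 3 → ℂ} {B : Fin 3 → Mat} {U V : Mat} {w v : Fin 3 → ℂ}

/-- The common kernel of the functionals `w` and `w B_j` is invariant. It contains `u_i`, nonzero
because `lam i ≠ 0`, and it is proper because `w ≠ 0`. -/
theorem not_isIrreducible_of_left (hp : GenericParams lam mu) (h : IsFrame B U V)
    (hs : IsSpectral lam mu (V * U)) (he : IsEigenPair mu (resInfinity B) w v) {i : Fin 3}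
    (hi : (w ᵥ* U) i = 0) (hG : ∀ j, (w ᵥ* U) j * (V * U) j i = 0) : ¬ IsIrreducible B := by
  intro hirr
  -- For `j ≠ i` the terms with `k = i` and `k = j` vanish, and the eigenvector equation for column
  -- `j` kills the third.
  have hcol : ∀ j, (w ᵥ* U) j = 0 → ∀ k, (w ᵥ* U) k * (V * U) k j = 0 := by
    intro j hj k
    have hc := h.col_sum he j
    rw [hj] at hc
    by_cases hij : j = i
    · rw [hij]; exact hG k
    · by_cases hkj : k = j
      · rw [hkj, hj, zero_mul]
      · by_cases hki : k = i
        · rw [hki, hi, zero_mul]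
        · fin_cases i <;> fin_cases j <;> fin_cases k <;> simp_all
  let W : Submodule ℂ (Fin 3 → ℂ) :=
    { carrier := {x | w ⬝ᵥ x = 0 ∧ ∀ j, w ⬝ᵥ (B j *ᵥ x) = 0}
      add_mem' := fun {x y} hx hy => ⟨by rw [dotProduct_add, hx.1, hy.1, add_zero], fun j => by
        rw [mulVec_add, dotProduct_add, hx.2, hy.2, add_zero]⟩
      zero_mem' := by simp
      smul_mem' := fun c x hx => ⟨by rw [dotProduct_smul, hx.1, smul_zero], fun j => by
        rw [mulVec_smul, dotProduct_smul, hx.2, smul_zero]⟩ }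
  have hmul : ∀ k j x, w ⬝ᵥ (B k *ᵥ (B j *ᵥ x)) = (w ᵥ* U) k * (V * U) k j * (V *ᵥ x) j :=
    fun k j x => by rw [mulVec_mulVec]; exact h.pairing_mul k j
  have hinv : ∀ j, ∀ x ∈ W, B j *ᵥ x ∈ W := by
    refine fun j x hx => ⟨hx.2 j, fun k => ?_⟩
    rw [hmul]
    have h1 := hx.2 j
    rw [h.bilin_eq] at h1
    rcases mul_eq_zero.1 h1 with h2 | h2
    · rw [hcol j h2 k, zero_mul]
    · rw [h2, mul_zero]
  rcases hirr W hinv with hW | hW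
  · have hu : (fun a => U a i) ∈ W := by
      have hUi : (fun a => U a i) = U *ᵥ Pi.single i 1 := by ext a; simp
      have hVU : ∀ j, (V *ᵥ (U *ᵥ Pi.single i 1)) j = (V * U) j i := fun j => by
        rw [mulVec_mulVec]; simp
      refine ⟨hi, fun j => ?_⟩
      rw [h.bilin_eq, hUi, hVU, hG]
    rw [hW, Submodule.mem_bot] at hu
    have : (V * U) i i = 0 := by
      rw [mul_apply]
      exact Finset.sum_eq_zero fun a _ => by rw [show U a i = 0 from congrFun hu a, mul_zero]
    rw [hs.diag] at this
    exact hp.not_int i 0 (by simpa using this)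
  · refine he.left_ne (funext fun a => ?_)
    have : (Pi.single a 1 : Fin 3 → ℂ) ∈ W := hW ▸ Submodule.mem_top
    simpa using this.1

/-- Dually, the span of the `B j v` is invariant. It is nonzero because it contains `mu 1 • v`, and
proper because `B i` annihilates it although `B i` has trace `lam i ≠ 0`. -/
theorem not_isIrreducible_of_right (hp : GenericParams lam mu) (h : IsFrame B U V)
    (hs : IsSpectral lam mu (V * U)) (he : IsEigenPair mu (resInfinity B) w v) {i : Fin 3}
    (hi : (V *ᵥ v) i = 0) (hG : ∀ j, (V * U) i j * (V *ᵥ v) j = 0) : ¬ IsIrreducible B := by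
  intro hirr
  have hrow : ∀ j, (V *ᵥ v) j = 0 → ∀ k, (V * U) j k * (V *ᵥ v) k = 0 := by
    intro j hj k
    have hc := h.row_sum he j
    rw [hj] at hc
    by_cases hij : j = i
    · rw [hij]; exact hG k
    · by_cases hkj : k = j
      · rw [hkj, hj, mul_zero]
      · by_cases hki : k = i
        · rw [hki, hi, mul_zero]
        · fin_cases i <;> fin_cases j <;> fin_cases k <;> simp_all
  have hBx : ∀ j x, B j *ᵥ x = (V *ᵥ x) j • fun a => U a j := fun j x => by
    rw [h j, vecMulVec_mulVec]
    ext a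
    simp [mulVec, mul_comm]
  have hVU : ∀ j k, (V *ᵥ fun a => U a k) j = (V * U) j k := fun j k => rfl
  let W : Submodule ℂ (Fin 3 → ℂ) := Submodule.span ℂ (Set.range fun j => B j *ᵥ v)
  have hmem : ∀ j, B j *ᵥ v ∈ W := fun j => Submodule.subset_span ⟨j, rfl⟩
  have hinv : ∀ k, ∀ x ∈ W, B k *ᵥ x ∈ W := by
    intro k x hx
    induction hx using Submodule.span_induction with
    | mem x hx =>
      obtain ⟨j, rfl⟩ := hx
      change B k *ᵥ (B j *ᵥ v) ∈ W
      rw [hBx k, hBx j, mulVec_smul, Pi.smul_apply, hVU, smul_eq_mul, mul_comm]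
      by_cases hk : (V *ᵥ v) k = 0
      · rw [hrow k hk j, zero_smul]
        exact W.zero_mem
      · have := hmem k
        rw [hBx] at this
        exact W.smul_mem _ ((W.smul_mem_iff hk).1 this)
    | zero => rw [mulVec_zero]; exact W.zero_mem
    | add x y _ _ hx hy => rw [mulVec_add]; exact W.add_mem hx hy
    | smul a x _ hx => rw [mulVec_smul]; exact W.smul_mem a hx
  rcases hirr W hinv with hW | hW
  · have h1 := he.right
    rw [resInfinity, neg_mulVec, add_mulVec, add_mulVec, neg_smul, neg_inj] at h1
    have h2 : mu 1 • v ∈ W := h1 ▸ W.add_mem (W.add_mem (hmem 0) (hmem 1)) (hmem 2)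
    rw [hW, Submodule.mem_bot] at h2
    exact smul_ne_zero (hp.ne_zero 1) he.right_ne h2
  · have hle : W ≤ LinearMap.ker (B i).mulVecLin := by
      refine Submodule.span_le.2 ?_
      rintro _ ⟨j, rfl⟩
      change B i *ᵥ (B j *ᵥ v) = 0
      rw [hBx i, hBx j, mulVec_smul, Pi.smul_apply, hVU, smul_eq_mul, mul_comm, hG, zero_smul]
    have htr : (V * U) i i = 0 := by
      have hx : (fun a => U a i) ∈ LinearMap.ker (B i).mulVecLin := hle (hW ▸ Submodule.mem_top)
      have hx' : B i *ᵥ (fun a => U a i) = 0 := hx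
      rw [hBx, hVU] at hx'
      rcases smul_eq_zero.1 hx' with h0 | h0
      · exact h0
      · rw [mul_apply]
        exact Finset.sum_eq_zero fun a _ => by rw [show U a i = 0 from congrFun h0 a, mul_zero]
    rw [hs.diag] at htr
    exact hp.not_int i 0 (by simpa using htr)

end Reducible

theorem eventually_eq_zero_or_of_mul {f g : ℂ → ℂ} {z : ℂ} (hf : AnalyticAt ℂ f z)
    (hg : AnalyticAt ℂ g z) (h : ∀ᶠ t in 𝓝 z, f t * g t = 0) :
    (∀ᶠ t in 𝓝 z, f t = 0) ∨ ∀ᶠ t in 𝓝 z, g t = 0 := by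
  rcases hf.eventually_eq_zero_or_eventually_ne_zero with h1 | h1
  · exact Or.inl h1
  · refine Or.inr ?_
    rcases hg.eventually_eq_zero_or_eventually_ne_zero with h2 | h2
    · exact h2
    · obtain ⟨t, ⟨a, b⟩, c⟩ := ((h1.and h2).and (h.filter_mono nhdsWithin_le_nhds)).exists
      exact absurd c (mul_ne_zero a b)

theorem HasDerivAt.eq_zero_of_eventually {f : ℂ → ℂ} {f' z : ℂ} (hf : HasDerivAt f f' z)
    (h : ∀ᶠ t in 𝓝 z, f t = 0) : f' = 0 :=
  (hf.congr_of_eventuallyEq (h.mono fun _ ht => ht.symm)).unique (hasDerivAt_const z 0)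

theorem IsSchlesingerFlow.analyticAt_pairing {U : Set ℂ} (hU : IsOpen U) {B : ℂ → Fin 3 → Mat}
    (h : IsSchlesingerFlow U B) (w v : Fin 3 → ℂ) (i : Fin 3) {t : ℂ} (ht : t ∈ U) :
    AnalyticAt ℂ (fun s => pairing w v (B s i)) t := by
  have : DifferentiableOn ℂ (fun s => pairing w v (B s i)) U := fun s hs => by
    refine DifferentiableAt.differentiableWithinAt ?_
    fin_cases i
    · exact ((h.zero s hs).pairing w v).differentiableAt
    · exact ((h.one s hs).pairing w v).differentiableAt
    · exact ((h.two s hs).pairing w v).differentiableAt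
  exact this.analyticAt (hU.mem_nhds ht)

/-- If `w B_i v` vanishes near `z`, then one of its factors `(w U) i`, `(V v) i` vanishes
identically there. Differentiating this with the Schlesinger equations, together with the
eigenvector equations, yields the hypotheses of `not_isIrreducible_of_left` or
`not_isIrreducible_of_right`. -/
theorem not_eventually_pairing_eq_zero {lam mu : Fin 3 → ℂ} (hp : GenericParams lam mu)
    {U : Set ℂ} (hU : IsOpen U) (h01 : U ⊆ {0, 1}ᶜ) {B : ℂ → Fin 3 → Mat}
    (hB : IsSchlesingerSolution lam mu U B) {w v : Fin 3 → ℂ} {z : ℂ} (hz : z ∈ U)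
    (he : IsEigenPair mu (resInfinity (B z)) w v) (hirr : IsIrreducible (B z)) (i : Fin 3) :
    ¬ ∀ᶠ t in 𝓝 z, pairing w v (B t i) = 0 := by
  intro hzero
  have hf := hB.flow
  obtain ⟨h0, h1⟩ : z ≠ 0 ∧ z - 1 ≠ 0 := by simpa [sub_eq_zero] using h01 hz
  obtain ⟨P, Q, hfr, hs, -⟩ := exists_frame hp.ne_zero (hB.mem_orbit z hz) (hB.mem_orbitInfinity z hz)
  have hlam : ∀ i, lam i ≠ 0 := fun i => by simpa using hp.not_int i 0
  -- Frames are chosen separately at each time, so their components need not be analytic. Pairing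
  -- with fixed test vectors, the `u_i` and `v_i` of the frame at `z`, gives analytic substitutes
  -- for the two factors; at `z` the extra factor is `lam i ≠ 0`.
  let v₀ : Fin 3 → ℂ := P *ᵥ Pi.single i 1
  let w₀ : Fin 3 → ℂ := Pi.single i 1 ᵥ* Q
  have hv₀ : (Q *ᵥ v₀) i ≠ 0 := by
    have : (Q *ᵥ v₀) i = (Q * P) i i := by simp only [v₀, mulVec_mulVec]; simp
    rw [this, hs.diag]; exact hlam i
  have hw₀ : (w₀ ᵥ* P) i ≠ 0 := by
    have : (w₀ ᵥ* P) i = (Q * P) i i := by simp only [w₀, vecMul_vecMul]; simp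
    rw [this, hs.diag]; exact hlam i
  have hprod : ∀ᶠ t in 𝓝 z, pairing w v₀ (B t i) * pairing w₀ v (B t i) = 0 := by
    filter_upwards [hzero, hU.mem_nhds hz] with t ht htU
    obtain ⟨P', Q', hfr', -⟩ :=
      exists_frame hp.ne_zero (hB.mem_orbit t htU) (hB.mem_orbitInfinity t htU)
    rw [hfr'.pairing_eq] at ht
    rw [hfr'.pairing_eq, hfr'.pairing_eq]
    linear_combination (Q' *ᵥ v₀) i * (w₀ ᵥ* P') i * ht
  have hlie : ∀ w v j k, pairing w v ⁅B z j, B z k⁆ =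
      (w ᵥ* P) j * (Q * P) j k * (Q *ᵥ v) k - (w ᵥ* P) k * (Q * P) k j * (Q *ᵥ v) j :=
    fun w v j k => by rw [pairing_lie, hfr.pairing_mul, hfr.pairing_mul]
  rcases eventually_eq_zero_or_of_mul (hf.analyticAt_pairing hU w v₀ i hz)
    (hf.analyticAt_pairing hU w₀ v i hz) hprod with hL | hR
  · have hi : (w ᵥ* P) i = 0 := by
      have := hL.self_of_nhds
      rw [hfr.pairing_eq] at this
      exact (mul_eq_zero.1 this).resolve_right hv₀
    refine not_isIrreducible_of_left hp hfr hs he hi (fun j => mul_right_cancel₀ hv₀ ?_) hirr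
    rw [zero_mul]
    have hcol := congrArg (· * (Q *ᵥ v₀) i) (hfr.col_sum he i)
    simp only [hi, mul_zero, zero_mul, add_mul] at hcol
    fin_cases i
    · have hd := HasDerivAt.eq_zero_of_eventually ((hf.zero z hz).pairing w v₀) hL
      rw [pairing_smul, hlie, mul_eq_zero, or_iff_right (inv_ne_zero h0)] at hd
      simp only [Fin.zero_eta] at *
      simp only [hi, zero_mul, sub_zero, zero_add] at hd hcol
      fin_cases j <;> simp only [Fin.zero_eta, Fin.mk_one, Fin.reduceFinMk]
      · simp [hi]
      · linear_combination hcol - hd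
      · exact hd
    · have hd := HasDerivAt.eq_zero_of_eventually ((hf.one z hz).pairing w v₀) hL
      rw [pairing_smul, hlie, mul_eq_zero, or_iff_right (inv_ne_zero h1)] at hd
      simp only [Fin.mk_one] at *
      simp only [hi, zero_mul, sub_zero, add_zero] at hd hcol
      fin_cases j <;> simp only [Fin.zero_eta, Fin.mk_one, Fin.reduceFinMk]
      · linear_combination hcol - hd
      · simp [hi]
      · exact hd
    -- For the moving pole the two unknown terms satisfy `A / z + B / (z - 1) = 0` and `A + B = 0`;
    -- these equations are independent, so both terms vanish.
    · have hd := HasDerivAt.eq_zero_of_eventually ((hf.two z hz).pairing w v₀) hL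
      rw [pairing_add, pairing_smul, pairing_smul, hlie, hlie] at hd
      simp only [Fin.reduceFinMk] at *
      simp only [hi, zero_mul, sub_zero, add_zero] at hd hcol
      field_simp at hd
      fin_cases j <;> simp only [Fin.zero_eta, Fin.mk_one, Fin.reduceFinMk]
      · linear_combination z * hcol - hd
      · linear_combination (1 - z) * hcol + hd
      · simp [hi]
  · have hi : (Q *ᵥ v) i = 0 := by
      have := hR.self_of_nhds
      rw [hfr.pairing_eq] at this
      exact (mul_eq_zero.1 this).resolve_left hw₀
    refine not_isIrreducible_of_right hp hfr hs he hi (fun j => mul_left_cancel₀ hw₀ ?_) hirr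
    rw [mul_zero]
    have hrow := congrArg ((w₀ ᵥ* P) i * ·) (hfr.row_sum he i)
    simp only [hi, mul_zero, mul_add] at hrow
    fin_cases i
    · have hd := HasDerivAt.eq_zero_of_eventually ((hf.zero z hz).pairing w₀ v) hR
      rw [pairing_smul, hlie, mul_eq_zero, or_iff_right (inv_ne_zero h0)] at hd
      simp only [Fin.zero_eta] at *
      simp only [hi, mul_zero, zero_sub, zero_add] at hd hrow
      fin_cases j <;> simp only [Fin.zero_eta, Fin.mk_one, Fin.reduceFinMk]
      · simp [hi]
      · linear_combination hrow + hd
      · linear_combination -hd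
    · have hd := HasDerivAt.eq_zero_of_eventually ((hf.one z hz).pairing w₀ v) hR
      rw [pairing_smul, hlie, mul_eq_zero, or_iff_right (inv_ne_zero h1)] at hd
      simp only [Fin.mk_one] at *
      simp only [hi, mul_zero, zero_sub, add_zero] at hd hrow
      fin_cases j <;> simp only [Fin.zero_eta, Fin.mk_one, Fin.reduceFinMk]
      · linear_combination hrow + hd
      · simp [hi]
      · linear_combination -hd
    · have hd := HasDerivAt.eq_zero_of_eventually ((hf.two z hz).pairing w₀ v) hR
      rw [pairing_add, pairing_smul, pairing_smul, hlie, hlie] at hd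
      simp only [Fin.reduceFinMk] at *
      simp only [hi, mul_zero, zero_sub, add_zero] at hd hrow
      field_simp at hd
      fin_cases j <;> simp only [Fin.zero_eta, Fin.mk_one, Fin.reduceFinMk]
      · linear_combination z * hrow + hd
      · linear_combination (1 - z) * hrow - hd
      · simp [hi]

theorem IsSchlesingerSolution.hasDerivAt_leadingCoeff {lam mu : Fin 3 → ℂ}
    (hp : GenericParams lam mu) {U : Set ℂ} (h01 : U ⊆ {0, 1}ᶜ) {B : ℂ → Fin 3 → Mat}
    (hB : IsSchlesingerSolution lam mu U B) {w v : Fin 3 → ℂ} {t : ℂ} (ht : t ∈ U)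
    (he : IsEigenPair mu (resInfinity (B t)) w v) :
    HasDerivAt (fun s => leadingCoeff w v (B s) s)
      ((mu 1 - mu 2 - 1) * pairing w v (B t 2)) t := by
  obtain ⟨h0, h1⟩ : t ≠ 0 ∧ t - 1 ≠ 0 := by simpa [sub_eq_zero] using h01 ht
  obtain ⟨P, Q, hfr, hs, -⟩ := exists_frame hp.ne_zero (hB.mem_orbit t ht) (hB.mem_orbitInfinity t ht)
  obtain ⟨r02, r21, r20, r10, r12⟩ := hfr.pairing_relations hs he
  have hsum := hp.sum_eq
  simp only [Fin.sum_univ_three] at hsum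
  have hm : lam 2 = mu 0 + mu 1 + mu 2 - lam 0 - lam 1 := by linear_combination hsum
  have d0 := (hB.flow.zero t ht).pairing w v
  have d1 := (hB.flow.one t ht).pairing w v
  simp only [pairing_smul, pairing_lie] at d0 d1
  refine (((hasDerivAt_id t).mul d0).add (((hasDerivAt_id t).sub_const 1).mul d1)).congr_deriv ?_
  have hp2 : pairing w v (B t 2) = -pairing w v (B t 0) - pairing w v (B t 1) := by
    linear_combination he.sum_pairing hp.distinct
  simp only [id]
  rw [r02, r12, r10, r20, r21, hm, hp2]
  field_simp
  ring

/-- The three pairings and the leading coefficient are analytic. The leading coefficient has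
derivative `(θ₄ - 1) w B_2 v`, so it cannot vanish identically when no pairing does. Nonvanishing of
the pairings excludes the values `0`, `1` and `t`. -/
theorem eventually_exists_apparentZero {lam mu : Fin 3 → ℂ} (hp : GenericParams lam mu)
    {U : Set ℂ} {B : ℂ → Fin 3 → Mat} (hU : IsOpen U) (h01 : U ⊆ {0, 1}ᶜ)
    (hB : IsSchlesingerSolution lam mu U B) (hth : mu 1 - mu 2 ≠ 1) {z : ℂ} (hz : z ∈ U)
    (hirr : IsIrreducible (B z)) :
    ∀ᶠ t in 𝓝[≠] z, ∃ h : ℂ, IsApparentZero mu (B t) t h ∧ h ≠ 0 ∧ h ≠ 1 ∧ h ≠ t := by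
  obtain ⟨r, hr, hrU⟩ := Metric.isOpen_iff.1 hU z hz
  obtain ⟨w, v, he⟩ := (hB.mono hrU).exists_eigenPair hp hr
  have hball := ball_mem_nhds z hr
  have hne : ∀ i, ∀ᶠ t in 𝓝[≠] z, pairing w v (B t i) ≠ 0 := fun i =>
    (hB.flow.analyticAt_pairing hU w v i hz).eventually_eq_zero_or_eventually_ne_zero.resolve_left
      (not_eventually_pairing_eq_zero hp hU h01 hB hz (he z (mem_ball_self hr)) hirr i)
  have hder : ∀ t ∈ ball z r, HasDerivAt (fun s => leadingCoeff w v (B s) s)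
      ((mu 1 - mu 2 - 1) * pairing w v (B t 2)) t := fun t ht =>
    hB.hasDerivAt_leadingCoeff hp h01 (hrU ht) (he t ht)
  have hcan : AnalyticAt ℂ (fun s => leadingCoeff w v (B s) s) z :=
    DifferentiableOn.analyticAt (s := ball z r)
      (fun t ht => (hder t ht).differentiableAt.differentiableWithinAt) hball
  have hc : ∀ᶠ t in 𝓝[≠] z, leadingCoeff w v (B t) t ≠ 0 := by
    refine hcan.eventually_eq_zero_or_eventually_ne_zero.resolve_left fun h0 => ?_
    refine not_eventually_pairing_eq_zero hp hU h01 hB hz (he z (mem_ball_self hr)) hirr 2 ?_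
    filter_upwards [h0.eventually_nhds, hball] with t ht htb
    exact (mul_eq_zero.1 (HasDerivAt.eq_zero_of_eventually (hder t htb) ht)).resolve_left
      (sub_ne_zero.2 hth)
  filter_upwards [hne 0, hne 1, hne 2, hc, nhdsWithin_le_nhds hball] with t n0 n1 n2 hct htb
  obtain ⟨h0, h1⟩ : t ≠ 0 ∧ t - 1 ≠ 0 := by simpa [sub_eq_zero] using h01 (hrU htb)
  have hq : leadingCoeff w v (B t) t * (t * pairing w v (B t 0) / leadingCoeff w v (B t) t) =
      t * pairing w v (B t 0) := by field_simp
  obtain ⟨e0, e1, e2⟩ := (he t htb).pairing_eq hp.distinct h0 h1 hq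
  refine ⟨_, ((he t htb).isApparentZero_iff hp.distinct (hB.mem_orbitInfinity t (hrU htb)) t _).2
    ⟨hct, hq⟩, fun h => n0 ?_, fun h => n1 ?_, fun h => n2 ?_⟩
  · rw [e0, h]; simp
  · rw [e1, h]; simp
  · rw [e2, h]; simp

/-! ### Realizing the Painlevé parameters -/

/-- The parameters fix `a`, `b`, `c` and `d - 1` only up to sign. If every choice with `d ≠ 0`
fails, the sign changes force `a * b = a * c = b * c = 0` and `a ^ 2 + b ^ 2 + c ^ 2 = d ^ 2`. With
`d = 1 ± T` this leaves `T = 0`, `d = 1` or `T = ±1`, `d = 2`, and in each case three positions for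
the nonzero entry: the six excluded points. -/
theorem exists_theta {α β γ δ : ℂ}
    (h : (α, β, γ, δ) ∉ ({(0, -1 / 2, 0, 1 / 2), (0, 0, 1 / 2, 1 / 2), (0, 0, 0, 0),
      (1 / 2, -2, 0, 1 / 2), (1 / 2, 0, 2, 1 / 2), (1 / 2, 0, 0, -3 / 2)} :
        Set (ℂ × ℂ × ℂ × ℂ))) :
    ∃ a b c d : ℂ, ((d - 1) ^ 2 / 2, -a ^ 2 / 2, b ^ 2 / 2, (1 - c ^ 2) / 2) = (α, β, γ, δ) ∧
      d ≠ 0 ∧ (a + b + c) ^ 2 ≠ d ^ 2 := by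
  by_contra! hno
  have hsq : ∀ x : ℂ, ∃ y, y ^ 2 = x := fun x => IsAlgClosed.exists_pow_nat_eq x two_pos
  obtain ⟨T, hT⟩ := hsq (2 * α)
  obtain ⟨a, ha⟩ := hsq (-2 * β)
  obtain ⟨b, hb⟩ := hsq (2 * γ)
  obtain ⟨c, hc⟩ := hsq (1 - 2 * δ)
  have hα : α = T ^ 2 / 2 := by linear_combination -hT / 2
  have hβ : β = -a ^ 2 / 2 := by linear_combination ha / 2
  have hγ : γ = b ^ 2 / 2 := by linear_combination -hb / 2
  have hδ : δ = (1 - c ^ 2) / 2 := by linear_combination hc / 2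
  have key : ∀ d, (d - 1) ^ 2 = T ^ 2 → d ≠ 0 →
      a * b = 0 ∧ a * c = 0 ∧ b * c = 0 ∧ a ^ 2 + b ^ 2 + c ^ 2 = d ^ 2 := by
    intro d hd hd0
    have hs : ∀ b' c', b' ^ 2 = b ^ 2 → c' ^ 2 = c ^ 2 → (a + b' + c') ^ 2 = d ^ 2 :=
      fun b' c' hb' hc' => hno a b' c' d (by rw [hd, hb', hc', hα, hβ, hγ, hδ]) hd0
    have s1 := hs b c rfl rfl
    have s2 := hs b (-c) rfl (neg_sq c)
    have s3 := hs (-b) c (neg_sq b) rfl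
    have s4 := hs (-b) (-c) (neg_sq b) (neg_sq c)
    refine ⟨?_, ?_, ?_, ?_⟩
    · linear_combination (s1 + s2 - s3 - s4) / 8
    · linear_combination (s1 - s2 + s3 - s4) / 8
    · linear_combination (s1 - s2 - s3 + s4) / 8
    · linear_combination (s1 + s2 + s3 + s4) / 4
  have hcases : (T ^ 2 = 0 ∧ a * b = 0 ∧ a * c = 0 ∧ b * c = 0 ∧ a ^ 2 + b ^ 2 + c ^ 2 = 1) ∨
      (T ^ 2 = 1 ∧ a * b = 0 ∧ a * c = 0 ∧ b * c = 0 ∧ a ^ 2 + b ^ 2 + c ^ 2 = 4) := by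
    by_cases h1 : 1 + T = 0
    · obtain ⟨p1, p2, p3, p4⟩ := key (1 - T) (by ring) fun h2 => by
        have : (2 : ℂ) = 0 := by linear_combination h1 + h2
        norm_num at this
      have hT1 : T = -1 := by linear_combination h1
      exact Or.inr ⟨by rw [hT1]; norm_num, p1, p2, p3, by rw [p4, hT1]; norm_num⟩
    · obtain ⟨p1, p2, p3, p4⟩ := key (1 + T) (by ring) h1
      by_cases h2 : 1 - T = 0
      · have hT1 : T = 1 := by linear_combination -h2
        exact Or.inr ⟨by rw [hT1]; norm_num, p1, p2, p3, by rw [p4, hT1]; norm_num⟩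
      · obtain ⟨-, -, -, p5⟩ := key (1 - T) (by ring) h2
        have hT0 : T = 0 := by linear_combination (p5 - p4) / 4
        exact Or.inl ⟨by rw [hT0]; norm_num, p1, p2, p3, by rw [p4, hT0]; norm_num⟩
  apply h
  simp only [Set.mem_insert_iff, Set.mem_singleton_iff, Prod.mk.injEq]
  have hzero : a * b = 0 → a * c = 0 → b * c = 0 →
      (b = 0 ∧ c = 0) ∨ (a = 0 ∧ c = 0) ∨ (a = 0 ∧ b = 0) := by
    intro p1 p2 p3
    rcases mul_eq_zero.1 p1 with h1 | h1 <;> rcases mul_eq_zero.1 p2 with h2 | h2 <;>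
      rcases mul_eq_zero.1 p3 with h3 | h3 <;> simp [*]
  rcases hcases with ⟨hT', p1, p2, p3, p4⟩ | ⟨hT', p1, p2, p3, p4⟩ <;>
    rcases hzero p1 p2 p3 with ⟨z1, z2⟩ | ⟨z1, z2⟩ | ⟨z1, z2⟩ <;>
    rw [z1, z2] at p4 <;>
    simp only [ne_eq, OfNat.ofNat_ne_zero, not_false_eq_true, zero_pow, add_zero, zero_add] at p4 <;>
    rw [hα, hβ, hγ, hδ, hT', p4, z1, z2] <;> norm_num

/-- With `mu 0 = m`, the sum rule and the `θ_i` determine everything else. The conditions `d ≠ 0`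
and `(a + b + c) ^ 2 ≠ d ^ 2` are distinctness of the `mu i`; `m` is free and need only avoid a
countable set. -/
theorem exists_params {α β γ δ : ℂ}
    (h : (α, β, γ, δ) ∉ ({(0, -1 / 2, 0, 1 / 2), (0, 0, 1 / 2, 1 / 2), (0, 0, 0, 0),
      (1 / 2, -2, 0, 1 / 2), (1 / 2, 0, 2, 1 / 2), (1 / 2, 0, 0, -3 / 2)} :
        Set (ℂ × ℂ × ℂ × ℂ))) :
    ∃ lam mu : Fin 3 → ℂ, GenericParams lam mu ∧ pviParams (theta lam mu) = (α, β, γ, δ) := by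
  obtain ⟨a, b, c, d, hth, hd, hs⟩ := exists_theta h
  have hs1 : a + b + c + d ≠ 0 := fun h0 => hs (by linear_combination (a + b + c - d) * h0)
  have hs2 : a + b + c - d ≠ 0 := fun h0 => hs (by linear_combination (a + b + c + d) * h0)
  have hcount : (({0, -((a + b + c + d) / 2), -((a + b + c - d) / 2)} : Set ℂ) ∪
      ((Set.range fun n : ℤ => (n : ℂ) - a) ∪ ((Set.range fun n : ℤ => (n : ℂ) - b) ∪
        Set.range fun n : ℤ => (n : ℂ) - c))).Countable :=
    (Set.toFinite _).countable.union ((Set.countable_range _).union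
      ((Set.countable_range _).union (Set.countable_range _)))
  obtain ⟨m, hm⟩ := (hcount.dense_compl ℝ).nonempty
  simp only [Set.mem_compl_iff, Set.mem_union, Set.mem_insert_iff, Set.mem_singleton_iff,
    Set.mem_range, not_or, not_exists] at hm
  obtain ⟨⟨m0, m1, m2⟩, ma, mb, mc⟩ := hm
  refine ⟨![a + m, b + m, c + m], ![m, m + (a + b + c + d) / 2, m + (a + b + c - d) / 2],
    ⟨?_, ?_, ?_, ?_⟩, ?_⟩
  · intro i n hn
    fin_cases i
    · exact ma n (sub_eq_of_eq_add' hn.symm)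
    · exact mb n (sub_eq_of_eq_add' hn.symm)
    · exact mc n (sub_eq_of_eq_add' hn.symm)
  · have n1 : m ≠ m + (a + b + c + d) / 2 := fun h => hs1 (by linear_combination -2 * h)
    have n2 : m ≠ m + (a + b + c - d) / 2 := fun h => hs2 (by linear_combination -2 * h)
    have n3 : m + (a + b + c + d) / 2 ≠ m + (a + b + c - d) / 2 :=
      fun h => hd (by linear_combination h)
    intro i j hij
    fin_cases i <;> fin_cases j <;> first | rfl | exact absurd hij ‹_› | exact absurd hij.symm ‹_›
  · intro i hi
    fin_cases i
    · exact m0 hi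
    · exact m1 (eq_neg_of_add_eq_zero_left hi)
    · exact m2 (eq_neg_of_add_eq_zero_left hi)
  · simp [Fin.sum_univ_three]
    ring
  · rw [← hth]
    simp only [pviParams, theta, cons_val]
    congr 2
    · ring
    · ring
    · congr 2 <;> ring

end RankThree

theorem mainTheorem2 :
    (∀ lam mu : Fin 3 → ℂ, RankThree.GenericParams lam mu →
      -- the Schlesinger equations imply the reduced equations
      (∀ (U : Set ℂ) (B : ℂ → Fin 3 → RankThree.Mat), IsOpen U → U ⊆ {0, 1}ᶜ →
        RankThree.IsSchlesingerSolution lam mu U B →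
        RankThree.IsReducedSolution lam mu U (fun t => RankThree.coordX (B t))
          (fun t => RankThree.coordY (B t)) (fun t => RankThree.coordF (B t))) ∧
      -- generic solutions of the reduced equations come from the Schlesinger equations, and only
      -- from one conjugacy class of solutions
      (∀ (c : ℂ) (r : ℝ) (x y f : ℂ → ℂ), 0 < r → Metric.ball c r ⊆ {0, 1}ᶜ →
        RankThree.IsReducedSolution lam mu (Metric.ball c r) x y f →
        (∃ t ∈ Metric.ball c r, f t ≠ 0) →
        (∀ t ∈ Metric.ball c r,
          x t ≠ 0 ∧ y t ≠ 0 ∧ RankThree.traceConst lam mu - x t - y t ≠ 0) →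
        (∃ B : ℂ → Fin 3 → RankThree.Mat,
          RankThree.IsSchlesingerSolution lam mu (Metric.ball c r) B ∧
          (∀ t ∈ Metric.ball c r, RankThree.coordX (B t) = x t ∧ RankThree.coordY (B t) = y t ∧
            RankThree.coordF (B t) = f t) ∧
          ∀ B' : ℂ → Fin 3 → RankThree.Mat,
            RankThree.IsSchlesingerSolution lam mu (Metric.ball c r) B' →
            (∀ t ∈ Metric.ball c r, RankThree.coordX (B' t) = x t ∧
              RankThree.coordY (B' t) = y t ∧ RankThree.coordF (B' t) = f t) →
            RankThree.ConjugateOn (Metric.ball c r) B B')) ∧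
      -- the Schlesinger equations imply the sixth Painlevé equation
      (∀ (U : Set ℂ) (B : ℂ → Fin 3 → RankThree.Mat) (η : ℂ → ℂ), IsOpen U → U ⊆ {0, 1}ᶜ →
        RankThree.IsSchlesingerSolution lam mu U B →
        (∀ t ∈ U, RankThree.IsApparentZero mu (B t) t (η t) ∧
          η t ≠ 0 ∧ η t ≠ 1 ∧ η t ≠ t) →
        RankThree.IsAssociatedPVISolution lam mu U η) ∧
      -- for irreducible systems the Painlevé function exists, regular, off a discrete set of times
      (∀ (U : Set ℂ) (B : ℂ → Fin 3 → RankThree.Mat), IsOpen U → U ⊆ {0, 1}ᶜ →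
        RankThree.IsSchlesingerSolution lam mu U B →
        (∀ i, lam i ≠ mu 0) → mu 1 - mu 2 ≠ 1 →
        ∀ t₀ ∈ U, RankThree.IsIrreducible (B t₀) →
          ∀ᶠ t in 𝓝[≠] t₀, ∃ h : ℂ, RankThree.IsApparentZero mu (B t) t h ∧
            h ≠ 0 ∧ h ≠ 1 ∧ h ≠ t) ∧
      -- every solution of the sixth Painlevé equation comes from the Schlesinger equations, and
      -- only from one conjugacy class of solutions
      (∀ (c : ℂ) (r : ℝ) (η : ℂ → ℂ), 0 < r → Metric.ball c r ⊆ {0, 1}ᶜ →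
        RankThree.IsAssociatedPVISolution lam mu (Metric.ball c r) η →
        (∃ B : ℂ → Fin 3 → RankThree.Mat,
          RankThree.IsSchlesingerSolution lam mu (Metric.ball c r) B ∧
          (∀ t ∈ Metric.ball c r, RankThree.IsApparentZero mu (B t) t (η t)) ∧
          ∀ B' : ℂ → Fin 3 → RankThree.Mat,
            RankThree.IsSchlesingerSolution lam mu (Metric.ball c r) B' →
            (∀ t ∈ Metric.ball c r, RankThree.IsApparentZero mu (B' t) t (η t)) →
            RankThree.ConjugateOn (Metric.ball c r) B B'))) ∧
    -- all four parameters of the sixth Painlevé equation occur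
    (∀ α β γ δ : ℂ,
      (α, β, γ, δ) ∉ ({(0, -1 / 2, 0, 1 / 2), (0, 0, 1 / 2, 1 / 2), (0, 0, 0, 0),
        (1 / 2, -2, 0, 1 / 2), (1 / 2, 0, 2, 1 / 2), (1 / 2, 0, 0, -3 / 2)} :
          Set (ℂ × ℂ × ℂ × ℂ)) →
      ∃ lam mu : Fin 3 → ℂ, RankThree.GenericParams lam mu ∧
        RankThree.pviParams (RankThree.theta lam mu) = (α, β, γ, δ)) := by
  refine ⟨fun lam mu hp => ⟨fun U B _ _ hB => RankThree.isReducedSolution_of_schlesinger hp hB,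
    fun c r x y f hr h01 h hf hne => RankThree.generic_converse hp c r x y f hr h01 h hf
      fun t ht => ⟨(hne t ht).1, (hne t ht).2.1⟩,
    fun U B η hU h01 hB hη => RankThree.isAssociatedPVISolution_of_schlesinger hp hU h01 hB hη,
    fun U B hU h01 hB _ hth t₀ ht₀ hirr =>
      RankThree.eventually_exists_apparentZero hp hU h01 hB hth ht₀ hirr,
    fun c r η hr h01 hη => RankThree.exists_schlesinger_of_pvi hp c r η hr h01 hη⟩,
    fun α β γ δ h => RankThree.exists_params h⟩
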